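/- **Conventions.** All logarithms are to base $2$ and $+$ on bits is addition modulo $2$. A BMS channel is a binary-input channel $W:\{0,1\}\to\mathcal Y$ with finite output alphabet such that some involution $\sigma$ of $\mathcal Y$ satisfies $W(y|1)=W(\sigma(y)|0)$ for all $y$. Its Bhattacharyya parameter is $Z(W)=\sum_y\sqrt{W(y|0)W(y|1)}$ and its symmetric capacity is $I(W)=\sum_{x,y}\tfrac12W(y|x)\log\frac{W(y|x)}{\frac12W(y|0)+\frac12W(y|1)}$. For two channels let $$(W_1\boxast W_2)(y_1,y_2|u_1)=\tfrac12\sum_{u_2}W_1(y_1|u_1+u_2)W_2(y_2|u_2),\qquad (W_1\circledast W_2)(y_1,y_2,u_1|u_2)=\tfrac12W_1(y_1|u_1+u_2)W_2(y_2|u_2).$$ **The constant $\eta$.** Fix $b\in(0,1)$, $c\in(0,\frac12)$, $\lambda>0$. Put $f(z)=z^b(1-z)^b$, $$g(z_1,z_2)=\sup\Big\{\tfrac{f(z_1z_2)+f(z^-)}{f(z_1)+f(z_2)}:\ \sqrt{z_1^2+z_2^2-z_1^2z_2^2}\le z^-\le z_1+z_2-z_1z_2\Big\},$$ let $h(z)$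 be the supremum of $g(z,z')$ over $z'\in[z,2z]$ if $z<c$, over $z'\in[z,\min(z+\lambda,1-c)]$ if $c\le z\le 1-c$, and over $z'\in[z,\frac{1+z}2]$ if $z>1-c$, and let $\eta=-\log\sup_{z\in(0,1)}h(z)$. Assume that $\eta>0$ (numerically, $\eta\approx0.139$ for $b=0.72$, $c=\lambda=0.1$). **Deterministic polarization.** A deterministic polarization of $2^m$ channels has $m$ levels. At each level every current block is permuted by some permutation of its positions; each pair $(A,B)$ of consecutive channels then contributes $A\boxast B$ to the first and $A\circledast B$ to the second of two half-length blocks, which are treated separately at the next level, unless the operation is skipped for this pair, in which case $A$ and $B$ themselves are contributed. A combined pair with inputs $u_1,u_2$ of its two bit-channels sends $u_1+u_2$ over $A$ and $u_2$ over $B$; a skipped pair sends $u_1$ over $A$ and $u_2$ over $B$. The permutations and skipped operations are part of the construction and may depend on the channels. **Two-stage polar codes.** For $N=2^n=N_1N_2$ with $N_1=2^{n_1}$, $N_2=2^{n_2}$, partition the $N$ channels into $N_2$ sets of $N_1$ channels and apply a deterministic polarization to each set. For some $M\le N_1$, select $M$ of the resulting bit-channels of each set, in increasing order; freeze the others to $0$.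 For each $r\le M$, apply a deterministic polarization to the $N_2$ channels formed by the $r$-th selected bit-channel of each set. Some of the resulting $MN_2$ bit-channels carry information bits; all others are frozen to $0$. The rate is $R=\frac1N\,|\{\text{information bits}\}|$. The successive-cancellation decoder decides the bits of the $M$ second-stage blocks one after another, block by block, each information bit by maximum likelihood for the channel from that bit to the received sequence and all preceding bits (subsequent bits being uniform), with the earlier decisions inserted for the preceding bits. The block error probability is the probability that some information bit is decided wrongly, for a uniformly random message and independent uses of the channels. **Theorem.** Let $P_e\in(0,1)$ and $$\mu>2+\log3+\frac1\eta .$$ There is a constant $\kappa>0$, depending only on $P_e$ and $\mu$ (and on the fixed $b,c,\lambda$), such that for every $n\ge0$, $N=2^n$, and all BMS channels $W_1,\dots,W_N$ there is a two-stage polar code of length $N$, whose information bits are exactly those of the $MN_2$ final bit-channels with Bhattacharyya parameter at most $P_e/N$, such that its block error probability over $W_1,\dots,W_N$ under successive-cancellation decoding is at most $P_e$ and its rate $R$ satisfies $$N\le\frac{\kappa}{(\overline I_N-R)^{\mu}}\quad\text{whenever } R<\overline I_N,\qquad\text{where } \overline I_N=\frac1N\sum_{i=1}^N I(W_i).$$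 -/

import Mathlib

open scoped BigOperators

universe u

noncomputable section

namespace NonstationaryPolar

/-! ### Binary-input discrete memoryless channels -/

/-- A binary-input channel `W : {0,1} → Out` with a finite output alphabet. The number
`W.prob x y` is the transition probability `W(y | x)`. -/
structure Channel where
  Out : Type u
  fintypeOut : Fintype Out
  prob : ZMod 2 → Out → ℝ
  prob_nonneg : ∀ x y, 0 ≤ prob x y
  prob_sum : ∀ x, ∑ y, prob x y = 1

attribute [instance] Channel.fintypeOut

namespace Channel

/-- The channel is symmetric: some involution `σ` of the output alphabet exchanges the
transition probabilities of the two inputs. -/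
def IsBMS (W : Channel.{u}) : Prop :=
  ∃ σ : Equiv.Perm W.Out, (∀ y, σ (σ y) = y) ∧ ∀ y, W.prob 1 y = W.prob 0 (σ y)

/-- Bhattacharyya parameter. -/
def bhatt (W : Channel.{u}) : ℝ :=
  ∑ y, Real.sqrt (W.prob 0 y * W.prob 1 y)

/-- Symmetric capacity in bits: the mutual information between a uniform input and the output.
(A summand with `W(y|x) = 0` is `0`.) -/
def symCap (W : Channel.{u}) : ℝ :=
  ∑ x : ZMod 2, ∑ y, (1 / 2) * W.prob x y *
    Real.logb 2 (W.prob x y / ((1 / 2) * W.prob 0 y + (1 / 2) * W.prob 1 y))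

/-- The upper combined channel
`(y₁, y₂ | u₁) ↦ ½ ∑_{u₂} W₁(y₁ | u₁ + u₂) W₂(y₂ | u₂)`. -/
def minus (W₁ W₂ : Channel.{u}) : Channel.{u} where
  Out := W₁.Out × W₂.Out
  fintypeOut := inferInstance
  prob u₁ y := (1 / 2) * ∑ u₂ : ZMod 2, W₁.prob (u₁ + u₂) y.1 * W₂.prob u₂ y.2
  prob_nonneg u₁ y := mul_nonneg (by norm_num)
    (Finset.sum_nonneg fun u₂ _ => mul_nonneg (W₁.prob_nonneg _ _) (W₂.prob_nonneg _ _))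
  prob_sum u₁ := by
    rw [← Finset.mul_sum, Finset.sum_comm]
    have h : ∀ u₂ : ZMod 2,
        ∑ y : W₁.Out × W₂.Out, W₁.prob (u₁ + u₂) y.1 * W₂.prob u₂ y.2 = 1 := fun u₂ => by
      rw [Fintype.sum_prod_type, ← Finset.sum_mul_sum, W₁.prob_sum, W₂.prob_sum, one_mul]
    simp [h]

/-- The lower combined channel
`(y₁, y₂, u₁ | u₂) ↦ ½ W₁(y₁ | u₁ + u₂) W₂(y₂ | u₂)`. -/
def plus (W₁ W₂ : Channel.{u}) : Channel.{u} where
  Out := (W₁.Out × W₂.Out) × ZMod 2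
  fintypeOut := inferInstance
  prob u₂ y := (1 / 2) * (W₁.prob (y.2 + u₂) y.1.1 * W₂.prob u₂ y.1.2)
  prob_nonneg u₂ y := mul_nonneg (by norm_num)
    (mul_nonneg (W₁.prob_nonneg _ _) (W₂.prob_nonneg _ _))
  prob_sum u₂ := by
    rw [← Finset.mul_sum, Fintype.sum_prod_type, Finset.sum_comm]
    have h : ∀ u₁ : ZMod 2,
        ∑ y : W₁.Out × W₂.Out, W₁.prob (u₁ + u₂) y.1 * W₂.prob u₂ y.2 = 1 := fun u₁ => by
      rw [Fintype.sum_prod_type, ← Finset.sum_mul_sum, W₁.prob_sum, W₂.prob_sum, one_mul]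
    simp [h]

end Channel

/-- Average symmetric capacity of a finite sequence of channels. -/
def avgCap {N : ℕ} (W : Fin N → Channel.{u}) : ℝ :=
  (∑ i, (W i).symCap) / N

/-! ### The constant `η` -/

/-- `f(z) = z^b (1 - z)^b`. -/
def fPot (b z : ℝ) : ℝ := z ^ b * (1 - z) ^ b

/-- `g(z₁, z₂)`: the supremum of `(f(z₁ z₂) + f(z⁻)) / (f(z₁) + f(z₂))` over
`z⁻ ∈ [√(z₁² + z₂² - z₁² z₂²), z₁ + z₂ - z₁ z₂]`. -/
def gRatio (b z₁ z₂ : ℝ) : ℝ :=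
  sSup ((fun zm => (fPot b (z₁ * z₂) + fPot b zm) / (fPot b z₁ + fPot b z₂)) ''
    Set.Icc (Real.sqrt (z₁ ^ 2 + z₂ ^ 2 - z₁ ^ 2 * z₂ ^ 2)) (z₁ + z₂ - z₁ * z₂))

/-- `h(z)`: the supremum of `g(z, z')` over `z'` in `[z, 2z]`, in `[z, min(z + lam, 1 - c)]` or in
`[z, (1 + z)/2]`, according to whether `z < c`, `c ≤ z ≤ 1 - c` or `1 - c < z`. -/
def hSup (b c lam z : ℝ) : ℝ :=
  if z < c then sSup (gRatio b z '' Set.Icc z (2 * z))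
  else if z ≤ 1 - c then sSup (gRatio b z '' Set.Icc z (min (z + lam) (1 - c)))
  else sSup (gRatio b z '' Set.Icc z ((1 + z) / 2))

/-- `η = -log₂ sup_{z ∈ (0,1)} h(z)`. -/
def eta (b c lam : ℝ) : ℝ :=
  -Real.logb 2 (sSup (hSup b c lam '' Set.Ioo 0 1))

/-! ### Deterministic polarization with permutations and skipped operations -/

/-- The sequence of length `2^(m+1)` with first half `a` and second half `b`. -/
def joinHalves {α : Type*} {m : ℕ} (a b : Fin (2 ^ m) → α) : Fin (2 ^ (m + 1)) → α :=
  fun p => if h : p.1 < 2 ^ m then a ⟨p.1, h⟩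
    else b ⟨p.1 - 2 ^ m, by have h2 := p.2; have h3 := pow_succ 2 m; omega⟩

/-- Position `i` of the first half of a block of length `2^(m+1)`. -/
def fstHalf {m : ℕ} (i : Fin (2 ^ m)) : Fin (2 ^ (m + 1)) :=
  ⟨i.1, by have := i.2; rw [pow_succ]; omega⟩

/-- Position `i` of the second half of a block of length `2^(m+1)`. -/
def sndHalf {m : ℕ} (i : Fin (2 ^ m)) : Fin (2 ^ (m + 1)) :=
  ⟨2 ^ m + i.1, by have := i.2; rw [pow_succ]; omega⟩

/-- First position of the `i`-th pair of consecutive positions of a block of length `2^(m+1)`. -/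
def fstOfPair {m : ℕ} (i : Fin (2 ^ m)) : Fin (2 ^ (m + 1)) :=
  ⟨2 * i.1, by have := i.2; rw [pow_succ]; omega⟩

/-- Second position of the `i`-th pair of consecutive positions of a block of length `2^(m+1)`. -/
def sndOfPair {m : ℕ} (i : Fin (2 ^ m)) : Fin (2 ^ (m + 1)) :=
  ⟨2 * i.1 + 1, by have := i.2; rw [pow_succ]; omega⟩

/-- The sequence of length `2^(m+1)` whose `i`-th pair of consecutive entries is `(a i, b i)`. -/
def joinPairs {α : Type*} {m : ℕ} (a b : Fin (2 ^ m) → α) : Fin (2 ^ (m + 1)) → α :=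
  fun p =>
    let i : Fin (2 ^ m) := ⟨p.1 / 2, by have h2 := p.2; have h3 := pow_succ 2 m; omega⟩
    if p.1 % 2 = 0 then a i else b i

/-- The permutations and skipped operations of a deterministic polarization of a block of `2^m`
channels. For a block of length `2^(m+1)`: the permutation `π` of its positions, for each of the
`2^m` pairs of consecutive permuted channels whether its combination is skipped (`T i = true`), and
the data for the two sub-blocks of length `2^m` of the next level. -/
inductive Polarization : ℕ → Type
  | nil : Polarization 0
  | level {m : ℕ} (π : Equiv.Perm (Fin (2 ^ (m + 1)))) (T : Fin (2 ^ m) → Bool)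
      (upper lower : Polarization m) : Polarization (m + 1)

namespace Polarization

/-- The bit-channels after all levels of the polarization. In each block, `W i` is replaced by
`W (π i)`; the `i`-th pair `(A, B)` then contributes `minus A B` to the first and `plus A B` to the
second sub-block, or `A` and `B` themselves if its combination is skipped. -/
def channels : {m : ℕ} → Polarization m → (Fin (2 ^ m) → Channel.{u}) → Fin (2 ^ m) → Channel.{u}
  | _, nil, W => W
  | _, level π T upper lower, W =>
    let A := fun i => W (π (fstOfPair i))
    let B := fun i => W (π (sndOfPair i))
    joinHalves
      (upper.channels fun i => if T i then A i else (A i).minus (B i))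
      (lower.channels fun i => if T i then B i else (A i).plus (B i))

/-- The encoding map belonging to the polarization: from the inputs of the bit-channels to the
inputs of the underlying channels. A combined pair with inputs `(u₁, u₂)` has the channel inputs
`(u₁ + u₂, u₂)`, a skipped pair has `(u₁, u₂)`. -/
def encode : {m : ℕ} → Polarization m → (Fin (2 ^ m) → ZMod 2) → Fin (2 ^ m) → ZMod 2
  | _, nil, x => x
  | _, level π T upper lower, x =>
    let a := upper.encode fun i => x (fstHalf i)
    let b := lower.encode fun i => x (sndHalf i)
    fun q => joinPairs (fun i => if T i then a i else a i + b i) b (π.symm q)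

end Polarization

/-! ### Polar codes from a two-stage polarization -/

/-- A polar code of length `2^n` obtained by two stages of deterministic polarization.

The `2^n` positions are partitioned into `2^n₂` sets of `2^n₁` positions; `part (k, i)` is the
`i`-th position of the `k`-th set. In the first stage the `k`-th set is polarized by `first k`. Of
the resulting bit-channels of the `k`-th set, `M` are selected, in increasing order
`sel k 0 < sel k 1 < ⋯`; the others are frozen. In the second stage, for each `r`, the `r`-th
selected bit-channels of the `2^n₂` sets are polarized by `second r`. The pair `(r, k)` stands for
the `k`-th of the resulting bit-channels; those in `info` carry information, the others are
frozen. -/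
structure TwoStageCode (n : ℕ) where
  n₁ : ℕ
  n₂ : ℕ
  add_eq : n₁ + n₂ = n
  part : Fin (2 ^ n₂) × Fin (2 ^ n₁) ≃ Fin (2 ^ n)
  first : Fin (2 ^ n₂) → Polarization n₁
  M : ℕ
  sel : Fin (2 ^ n₂) → (Fin M ↪o Fin (2 ^ n₁))
  second : Fin M → Polarization n₂
  info : Finset (Fin M × Fin (2 ^ n₂))

namespace TwoStageCode

variable {n : ℕ} (C : TwoStageCode n)

/-- The final bit-channels of the two-stage polarization of `W`. -/
def bitChannel (W : Fin (2 ^ n) → Channel.{u}) (p : Fin C.M × Fin (2 ^ C.n₂)) : Channel.{u} :=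
  (C.second p.1).channels
    (fun k => (C.first k).channels (fun i => W (C.part (k, i))) (C.sel k p.1)) p.2

/-- Rate of the code. -/
def rate : ℝ := (C.info.card : ℝ) / 2 ^ n

/-- An assignment of bits to all `2^n` final bit-channels: `w k (sel k r)` is the input of the
bit-channel `(r, k)` of the second stage, and `w k i`, for `i` not selected in the `k`-th set, is
the input of the `i`-th first-stage bit-channel of the `k`-th set. -/
abbrev Word : Type := Fin (2 ^ C.n₂) → Fin (2 ^ C.n₁) → ZMod 2

open Classical in
/-- The inputs of the first-stage bit-channels. -/
def stageTwo (w : C.Word) : C.Word := fun k i =>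
  if h : ∃ r, C.sel k r = i then
    (C.second h.choose).encode (fun k' => w k' (C.sel k' h.choose)) k
  else w k i

/-- The sequence of bits sent over the channels `W 0, W 1, …`. -/
def codeword (w : C.Word) : Fin (2 ^ n) → ZMod 2 := fun j =>
  (C.first (C.part.symm j).1).encode (C.stageTwo w (C.part.symm j).1) (C.part.symm j).2

/-- Probability of receiving `y` when `w` is encoded and sent over the independent channels
`W`. -/
def transition (W : Fin (2 ^ n) → Channel.{u}) (y : ∀ j, (W j).Out) (w : C.Word) : ℝ :=
  ∏ j, (W j).prob (C.codeword w j) (y j)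

/-- In the order of successive cancellation, the bit `w k' i'` precedes the bit of the bit-channel
`(r, k)`. -/
def Precedes (k' : Fin (2 ^ C.n₂)) (i' : Fin (2 ^ C.n₁)) (r : Fin C.M) (k : Fin (2 ^ C.n₂)) :
    Prop :=
  i' < C.sel k' r ∨ (i' = C.sel k' r ∧ k' < k)

open Classical in
/-- The transition probability of the channel from the bit of `(r, k)` to the received sequence `y`
and all preceding bits (read off from `s`), all other bits being uniformly distributed, given that
the bit of `(r, k)` is `b`. -/
def likelihood (W : Fin (2 ^ n) → Channel.{u}) (y : ∀ j, (W j).Out) (s : C.Word)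
    (r : Fin C.M) (k : Fin (2 ^ C.n₂)) (b : ZMod 2) : ℝ :=
  (1 / 2) ^ (2 ^ n - 1) *
    ∑ w : C.Word,
      if (∀ k' i', C.Precedes k' i' r k → w k' i' = s k' i') ∧ w k (C.sel k r) = b
      then C.transition W y w else 0

open Classical in
/-- One step of successive cancellation: the bit of `(r, k)` is decided from `y` and the preceding
decisions in `s`, by maximum likelihood if it carries information; otherwise it is `0`. -/
def scStep (W : Fin (2 ^ n) → Channel.{u}) (y : ∀ j, (W j).Out) (s : C.Word)
    (r : Fin C.M) (k : Fin (2 ^ C.n₂)) : C.Word := fun k' i' =>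
  if k' = k ∧ i' = C.sel k r then
    if (r, k) ∈ C.info ∧ C.likelihood W y s r k 0 < C.likelihood W y s r k 1 then 1 else 0
  else s k' i'

/-- The successive-cancellation decoder: `(r, k)` runs through all bit-channels of the second
stage, for `r = 0, 1, …` and, for each `r`, for `k = 0, 1, …`. All frozen bits are `0`. -/
def scDecode (W : Fin (2 ^ n) → Channel.{u}) (y : ∀ j, (W j).Out) : C.Word :=
  Fin.foldl C.M (fun s r => Fin.foldl (2 ^ C.n₂) (fun s k => C.scStep W y s r k) s)
    (fun _ _ => 0)

open Classical in
/-- The assignment of bits with the message `msg` on the information bits and `0` elsewhere. -/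
def word (msg : C.info → ZMod 2) : C.Word := fun k i =>
  if h : ∃ p : C.info, p.1.2 = k ∧ C.sel p.1.2 p.1.1 = i then msg h.choose else 0

open Classical in
/-- Block error probability under successive-cancellation decoding, for a uniformly distributed
message sent over the independent channels `W`. -/
def blockError (W : Fin (2 ^ n) → Channel.{u}) : ℝ :=
  (∑ msg : C.info → ZMod 2, ∑ y : ∀ j, (W j).Out,
    if ∃ p : C.info, C.scDecode W y p.1.2 (C.sel p.1.2 p.1.1) ≠ msg p
    then C.transition W y (C.word msg) else 0) / 2 ^ C.info.card

end TwoStageCode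

end NonstationaryPolar

end

/-!
The block is not divided: the code has `N₁ = N` and `N₂ = 1`, and its polarization consists of
`k` levels in which channels sorted by Bhattacharyya parameter are paired with their neighbours
(pairs whose combination does not contract the potential `f` are skipped), and of `m` levels of
unpermuted polarization of sorted sub-blocks of length `2^m`. All other operations are skipped.
-/

noncomputable section

namespace NonstationaryPolar

/-! ### Bhattacharyya parameters of combined channels -/

namespace Channel

/-! A combination conserves the sum of the two capacities (`symCap_minus_add_plus`), so with the
information set fixed by the threshold θ = Pe/N, the gap between average capacity and rate is
exactly the average of `loss θ` over the final bit-channels. It suffices to build a polarization of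
all N channels whose average loss is O(N^(-1/μ)).

Sorted levels. When neighbours in a sorted block are paired, either the pair contracts the potential
f by 2^(-η), or the jump of the monotone bounded function `gapFn` across the pair exceeds the
potential of the pair (`contraction_or_gap`). Pairs without contraction are skipped; along a sorted
block the jumps telescope, so each block loses only a constant. After k levels the total potential
is at most about 2^(-ηk) N + O(2^k).

Plain levels. Each of the 2^k blocks is sorted once more and cut into sub-blocks of length 2^m.
Channels in a sub-block share a bound x on Z or on 1 - Z², and a combination turns x into 2x or x².
Below a small x₀ the averages of x^b do not increase, while those of x^s shrink by the factor ρ/2;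
hence the average loss is at most (x/x₀)^b + (ρ/2)^m (x/θ)^s (`lossBound_step`). The sum of x^b is
controlled by the potential, up to a telescoping error O(2^m) per block (`rangeState_rpow_le`).

The total O(2^(-ηk) N + 2^(k+m)) + N (ρ/2)^m (1/θ)^s is balanced in `exists_levels`, with k about
n/(μη) and m at least about 2n/μ while k + m ≤ n - n/μ. This is possible as soon as μ ≥ 3 + 1/η,
which the hypothesis implies because log 3 ≥ 1.

Error probability. Each final bit-channel is the channel to some statistic of the received sequence
and the preceding bits (`isBitChannel_channels`), which is enough to bound the maximum-likelihood
error by Z on average over all words. Symmetry of the channels makes this error independent of the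
word, so freezing bits to 0 is harmless, and a union bound gives at most N · Pe/N. -/

theorem sum_zmod_two {M : Type*} [AddCommMonoid M] (g : ZMod 2 → M) : ∑ x, g x = g 0 + g 1 :=
  Fin.sum_univ_two g

/-- Output distribution under a uniform input. -/
def outProb (W : Channel.{u}) (y : W.Out) : ℝ := (W.prob 0 y + W.prob 1 y) / 2

theorem outProb_nonneg (W : Channel.{u}) (y : W.Out) : 0 ≤ W.outProb y := by
  have h0 := W.prob_nonneg 0 y
  have h1 := W.prob_nonneg 1 y
  unfold outProb; positivity

theorem sum_outProb (W : Channel.{u}) : ∑ y, W.outProb y = 1 := by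
  simp only [outProb, ← Finset.sum_div, Finset.sum_add_distrib, W.prob_sum]
  norm_num

/-- The summand `√(W(y|0) W(y|1))` of the Bhattacharyya parameter. -/
def overlap (W : Channel.{u}) (y : W.Out) : ℝ := Real.sqrt (W.prob 0 y * W.prob 1 y)

theorem overlap_nonneg (W : Channel.{u}) (y : W.Out) : 0 ≤ W.overlap y := Real.sqrt_nonneg _

theorem overlap_sq (W : Channel.{u}) (y : W.Out) :
    W.overlap y ^ 2 = W.prob 0 y * W.prob 1 y :=
  Real.sq_sqrt (mul_nonneg (W.prob_nonneg _ _) (W.prob_nonneg _ _))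

theorem overlap_le (W : Channel.{u}) (y : W.Out) : W.overlap y ≤ W.outProb y := by
  refine Real.sqrt_le_iff.2 ⟨W.outProb_nonneg y, ?_⟩
  unfold outProb
  nlinarith [sq_nonneg (W.prob 0 y - W.prob 1 y)]

theorem sum_overlap (W : Channel.{u}) : ∑ y, W.overlap y = W.bhatt := rfl

theorem bhatt_nonneg (W : Channel.{u}) : 0 ≤ W.bhatt :=
  Finset.sum_nonneg fun _ _ => Real.sqrt_nonneg _

theorem bhatt_le_one (W : Channel.{u}) : W.bhatt ≤ 1 := by
  rw [← W.sum_overlap, ← W.sum_outProb]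
  exact Finset.sum_le_sum fun y _ => W.overlap_le y

theorem bhatt_plus (W₁ W₂ : Channel.{u}) : (W₁.plus W₂).bhatt = W₁.bhatt * W₂.bhatt := by
  have h : ∀ (y₁ : W₁.Out) (y₂ : W₂.Out) (u : ZMod 2),
      Real.sqrt ((W₁.plus W₂).prob 0 ((y₁, y₂), u) * (W₁.plus W₂).prob 1 ((y₁, y₂), u)) =
        (1 / 2) * (W₁.overlap y₁ * W₂.overlap y₂) := by
    intro y₁ y₂ u
    have h1 : (W₁.plus W₂).prob 0 ((y₁, y₂), u) * (W₁.plus W₂).prob 1 ((y₁, y₂), u) =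
        ((1 / 2) * (W₁.overlap y₁ * W₂.overlap y₂)) ^ 2 := by
      rw [mul_pow, mul_pow, overlap_sq, overlap_sq]
      have h3 : (1 : ZMod 2) + 1 = 0 := by decide
      obtain rfl | rfl : u = 0 ∨ u = 1 := by revert u; decide
      · simp [plus]; ring
      · simp [plus, h3]; ring
    rw [h1, Real.sqrt_sq]
    have := W₁.overlap_nonneg y₁
    have := W₂.overlap_nonneg y₂
    positivity
  rw [← W₁.sum_overlap, ← W₂.sum_overlap, Finset.sum_mul_sum]
  change ∑ y : (W₁.Out × W₂.Out) × ZMod 2, _ = _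
  rw [Fintype.sum_prod_type, Fintype.sum_prod_type]
  simp only [h, sum_zmod_two]
  refine Finset.sum_congr rfl fun _ _ => Finset.sum_congr rfl fun _ _ => ?_
  ring

theorem bhatt_minus_eq (W₁ W₂ : Channel.{u}) :
    (W₁.minus W₂).bhatt = ∑ y₁, ∑ y₂, Real.sqrt ((W₁.overlap y₁ * W₂.outProb y₂) ^ 2 +
      (W₂.overlap y₂ * W₁.outProb y₁) ^ 2 - (W₁.overlap y₁ * W₂.overlap y₂) ^ 2) := by
  change ∑ y : W₁.Out × W₂.Out, _ = _
  rw [Fintype.sum_prod_type]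
  refine Finset.sum_congr rfl fun y₁ _ => Finset.sum_congr rfl fun y₂ _ => ?_
  congr 1
  simp only [mul_pow, overlap_sq]
  have h3 : (1 : ZMod 2) + 1 = 0 := by decide
  simp [minus, outProb, sum_zmod_two, h3]
  ring

theorem bhatt_minus_le (W₁ W₂ : Channel.{u}) :
    (W₁.minus W₂).bhatt ≤ W₁.bhatt + W₂.bhatt - W₁.bhatt * W₂.bhatt := by
  have h : ∀ y₁ y₂, Real.sqrt ((W₁.overlap y₁ * W₂.outProb y₂) ^ 2 +
      (W₂.overlap y₂ * W₁.outProb y₁) ^ 2 - (W₁.overlap y₁ * W₂.overlap y₂) ^ 2) ≤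
      W₁.overlap y₁ * W₂.outProb y₂ + W₁.outProb y₁ * W₂.overlap y₂ -
        W₁.overlap y₁ * W₂.overlap y₂ := by
    intro y₁ y₂
    have a1 := W₁.overlap_nonneg y₁
    have a2 := W₂.overlap_nonneg y₂
    have b1 := W₁.overlap_le y₁
    have b2 := W₂.overlap_le y₂
    have c1 := mul_nonneg (sub_nonneg.2 b1) a2
    have c2 := mul_nonneg a1 (a2.trans b2)
    refine Real.sqrt_le_iff.2 ⟨by linarith, ?_⟩
    -- The difference of the squares is 2 o₁ o₂ (p₁ - o₁)(p₂ - o₂), with o the overlaps and p the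
    -- output probabilities.
    nlinarith [mul_nonneg (mul_nonneg a1 a2) (mul_nonneg (sub_nonneg.2 b1) (sub_nonneg.2 b2))]
  rw [bhatt_minus_eq]
  refine (Finset.sum_le_sum fun y₁ _ => Finset.sum_le_sum fun y₂ _ => h y₁ y₂).trans_eq ?_
  simp only [Finset.sum_add_distrib, Finset.sum_sub_distrib, ← Finset.mul_sum, ← Finset.sum_mul,
    sum_outProb, sum_overlap]
  ring

/-- Triangle inequality in the plane. -/
theorem sqrt_sum_sq_le {ι : Type*} (s : Finset ι) (p q : ι → ℝ) :
    Real.sqrt ((∑ i ∈ s, p i) ^ 2 + (∑ i ∈ s, q i) ^ 2) ≤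
      ∑ i ∈ s, Real.sqrt (p i ^ 2 + q i ^ 2) := by
  have h : ∀ x y : ℝ, Real.sqrt (x ^ 2 + y ^ 2) = ‖(⟨x, y⟩ : ℂ)‖ := by
    intro x y
    rw [Complex.norm_def, Complex.normSq_mk]; congr 1; ring
  simp only [h]
  refine le_trans (le_of_eq ?_) (norm_sum_le _ _)
  congr 1
  apply Complex.ext <;> simp

/-- Each summand of `bhatt_minus_eq` is the norm of a plane vector that is linear in the pair
(overlap, output probability) of one channel when the other is fixed. The triangle inequality
therefore allows averaging over `y₂` and then over `y₁`. -/
theorem le_bhatt_minus (W₁ W₂ : Channel.{u}) :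
    Real.sqrt (W₁.bhatt ^ 2 + W₂.bhatt ^ 2 - W₁.bhatt ^ 2 * W₂.bhatt ^ 2) ≤
      (W₁.minus W₂).bhatt := by
  have step1 : ∀ y₁, Real.sqrt ((W₁.overlap y₁) ^ 2 + (W₂.bhatt * W₁.outProb y₁) ^ 2 -
      (W₁.overlap y₁ * W₂.bhatt) ^ 2) ≤
      ∑ y₂, Real.sqrt ((W₁.overlap y₁ * W₂.outProb y₂) ^ 2 +
      (W₂.overlap y₂ * W₁.outProb y₁) ^ 2 - (W₁.overlap y₁ * W₂.overlap y₂) ^ 2) := by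
    intro y₁
    have hn : 0 ≤ W₁.outProb y₁ ^ 2 - W₁.overlap y₁ ^ 2 := by
      nlinarith [W₁.overlap_nonneg y₁, W₁.overlap_le y₁]
    have := sqrt_sum_sq_le Finset.univ (fun y₂ => W₁.overlap y₁ * W₂.outProb y₂)
      (fun y₂ => W₂.overlap y₂ * Real.sqrt (W₁.outProb y₁ ^ 2 - W₁.overlap y₁ ^ 2))
    simp only [← Finset.mul_sum, ← Finset.sum_mul, sum_outProb, sum_overlap] at this
    refine le_trans (le_of_eq ?_) (this.trans_eq (Finset.sum_congr rfl fun y₂ _ => ?_)) <;>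
      congr 1
    · rw [mul_pow W₂.bhatt, mul_pow W₂.bhatt, Real.sq_sqrt hn]; ring
    · rw [mul_pow (W₂.overlap y₂), mul_pow (W₂.overlap y₂), Real.sq_sqrt hn]; ring
  rw [bhatt_minus_eq]
  refine le_trans ?_ (Finset.sum_le_sum fun y₁ _ => step1 y₁)
  have hn : 0 ≤ 1 - W₂.bhatt ^ 2 := by nlinarith [W₂.bhatt_nonneg, W₂.bhatt_le_one]
  have := sqrt_sum_sq_le Finset.univ (fun y₁ => W₂.bhatt * W₁.outProb y₁)
    (fun y₁ => W₁.overlap y₁ * Real.sqrt (1 - W₂.bhatt ^ 2))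
  simp only [← Finset.mul_sum, ← Finset.sum_mul, sum_outProb, sum_overlap] at this
  refine le_trans (le_of_eq ?_) (this.trans_eq (Finset.sum_congr rfl fun y₁ _ => ?_)) <;> congr 1
  · rw [mul_pow W₁.bhatt, Real.sq_sqrt hn]; ring
  · rw [mul_pow (W₁.overlap y₁) (Real.sqrt _), Real.sq_sqrt hn]; ring

/-! ### Symmetric capacity: conservation and an upper bound -/

/-- The function `x log₂ x`. -/
def mulLog (x : ℝ) : ℝ := x * Real.logb 2 x

theorem mulLog_mul (x y : ℝ) : mulLog (x * y) = y * mulLog x + x * mulLog y := by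
  unfold mulLog
  rcases eq_or_ne x 0 with rfl | hx
  · simp
  rcases eq_or_ne y 0 with rfl | hy
  · simp
  rw [Real.logb_mul hx hy]; ring

theorem mulLog_half_mul (x : ℝ) : mulLog (1 / 2 * x) = mulLog x / 2 - x / 2 := by
  rw [mulLog_mul]
  have : mulLog (1 / 2) = - (1 / 2) := by
    unfold mulLog
    rw [one_div, Real.logb_inv, Real.logb_self_eq_one (by norm_num)]; ring
  rw [this]; ring

theorem mul_logb_div {a p : ℝ} (h : p = 0 → a = 0) :
    a * Real.logb 2 (a / p) = mulLog a - a * Real.logb 2 p := by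
  unfold mulLog
  rcases eq_or_ne a 0 with rfl | ha
  · simp
  rw [Real.logb_div ha fun hp => ha (h hp)]; ring

theorem symCap_eq (W : Channel.{u}) :
    W.symCap = ∑ y, (mulLog (W.prob 0 y) / 2 + mulLog (W.prob 1 y) / 2 - mulLog (W.outProb y)) := by
  unfold symCap
  rw [sum_zmod_two, ← Finset.sum_add_distrib]
  refine Finset.sum_congr rfl fun y _ => ?_
  have hp : (1 / 2) * W.prob 0 y + (1 / 2) * W.prob 1 y = W.outProb y := by
    unfold outProb; ring
  have h0 := W.prob_nonneg 0 y
  have h1 := W.prob_nonneg 1 y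
  rw [hp, mul_assoc, mul_assoc, mul_logb_div, mul_logb_div]
  · have : mulLog (W.outProb y) =
        (W.prob 0 y + W.prob 1 y) / 2 * Real.logb 2 (W.outProb y) := rfl
    rw [this]; ring
  · intro h; rw [← hp] at h; linarith
  · intro h; rw [← hp] at h; linarith

/-- This is the chain rule for mutual information. For fixed outputs, the output probability of the
plus channel at `u` is half the transition probability of the minus channel at input `u`, so these
entropy terms cancel and what remains splits into the contributions of the two channels. -/
theorem symCap_minus_add_plus (W₁ W₂ : Channel.{u}) :
    (W₁.minus W₂).symCap + (W₁.plus W₂).symCap = W₁.symCap + W₂.symCap := by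
  have h3 : (1 : ZMod 2) + 1 = 0 := by decide
  have key : ∀ y₁ y₂,
      (mulLog ((W₁.minus W₂).prob 0 (y₁, y₂)) / 2 + mulLog ((W₁.minus W₂).prob 1 (y₁, y₂)) / 2 -
        mulLog ((W₁.minus W₂).outProb (y₁, y₂))) +
      ∑ u : ZMod 2, (mulLog ((W₁.plus W₂).prob 0 ((y₁, y₂), u)) / 2 +
        mulLog ((W₁.plus W₂).prob 1 ((y₁, y₂), u)) / 2 -
        mulLog ((W₁.plus W₂).outProb ((y₁, y₂), u))) =
      (mulLog (W₁.prob 0 y₁) / 2 + mulLog (W₁.prob 1 y₁) / 2 - mulLog (W₁.outProb y₁)) *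
        W₂.outProb y₂ + W₁.outProb y₁ *
      (mulLog (W₂.prob 0 y₂) / 2 + mulLog (W₂.prob 1 y₂) / 2 - mulLog (W₂.outProb y₂)) := by
    intro y₁ y₂
    have e1 : (W₁.minus W₂).outProb (y₁, y₂) = W₁.outProb y₁ * W₂.outProb y₂ := by
      simp [outProb, minus, sum_zmod_two, h3]; ring
    have e2 : (W₁.plus W₂).outProb ((y₁, y₂), 0) = 1 / 2 * (W₁.minus W₂).prob 0 (y₁, y₂) := by
      simp [outProb, minus, plus, sum_zmod_two]; ring
    have e3 : (W₁.plus W₂).outProb ((y₁, y₂), 1) = 1 / 2 * (W₁.minus W₂).prob 1 (y₁, y₂) := by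
      simp [outProb, minus, plus, sum_zmod_two, h3]; ring
    have e4 : (W₁.plus W₂).prob 0 ((y₁, y₂), 0) = 1 / 2 * (W₁.prob 0 y₁ * W₂.prob 0 y₂) := by
      simp [plus]
    have e5 : (W₁.plus W₂).prob 1 ((y₁, y₂), 0) = 1 / 2 * (W₁.prob 1 y₁ * W₂.prob 1 y₂) := by
      simp [plus]
    have e6 : (W₁.plus W₂).prob 0 ((y₁, y₂), 1) = 1 / 2 * (W₁.prob 1 y₁ * W₂.prob 0 y₂) := by
      simp [plus]
    have e7 : (W₁.plus W₂).prob 1 ((y₁, y₂), 1) = 1 / 2 * (W₁.prob 0 y₁ * W₂.prob 1 y₂) := by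
      simp [plus, h3]
    have e8 : (W₁.minus W₂).prob 0 (y₁, y₂) + (W₁.minus W₂).prob 1 (y₁, y₂) =
        2 * (W₁.outProb y₁ * W₂.outProb y₂) := by rw [← e1]; unfold outProb; ring
    rw [sum_zmod_two, e1, e2, e3, e4, e5, e6, e7]
    simp only [mulLog_half_mul]
    simp only [mulLog_mul]
    have q1 : W₁.outProb y₁ = (W₁.prob 0 y₁ + W₁.prob 1 y₁) / 2 := rfl
    have q2 : W₂.outProb y₂ = (W₂.prob 0 y₂ + W₂.prob 1 y₂) / 2 := rfl
    generalize mulLog (W₁.outProb y₁) = t1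
    generalize mulLog (W₂.outProb y₂) = t2
    rw [q1, q2] at e8 ⊢
    linear_combination (1 / 2) * e8
  simp only [symCap_eq]
  have s1 : ∀ g : (W₁.minus W₂).Out → ℝ, ∑ y, g y = ∑ y₁ : W₁.Out, ∑ y₂ : W₂.Out, g (y₁, y₂) :=
    fun g => Fintype.sum_prod_type (f := g)
  have s2 : ∀ g : (W₁.plus W₂).Out → ℝ,
      ∑ y, g y = ∑ y₁ : W₁.Out, ∑ y₂ : W₂.Out, ∑ u : ZMod 2, g ((y₁, y₂), u) := fun g =>
    (Fintype.sum_prod_type (f := g)).trans (Fintype.sum_prod_type _)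
  rw [s1, s2]
  simp only [← Finset.sum_add_distrib]
  rw [Finset.sum_congr rfl fun y₁ _ => Finset.sum_congr rfl fun y₂ _ => key y₁ y₂]
  simp only [Finset.sum_add_distrib, ← Finset.mul_sum, ← Finset.sum_mul, sum_outProb]
  ring

theorem mulLog_add_mulLog_le {p d : ℝ} (hp : 0 ≤ p) (hd : 0 ≤ d) (hdp : d ≤ p) :
    mulLog (p + d) / 2 + mulLog (p - d) / 2 - mulLog p ≤ d := by
  rcases hp.eq_or_lt with rfl | hp
  · obtain rfl : d = 0 := le_antisymm hdp hd
    simp [mulLog]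
  obtain ⟨t, rfl⟩ : ∃ t, d = p * t := ⟨d / p, by field_simp⟩
  have ht0 : 0 ≤ t := nonneg_of_mul_nonneg_right hd hp
  have ht1 : t ≤ 1 := by by_contra! h; nlinarith
  have e1 : p + p * t = p * (1 + t) := by ring
  have e2 : p - p * t = p * (1 - t) := by ring
  rw [e1, e2, mulLog_mul, mulLog_mul]
  have h1 : mulLog (1 - t) ≤ 0 :=
    mul_nonpos_of_nonneg_of_nonpos (by linarith)
      (Real.logb_nonpos (by norm_num) (by linarith) (by linarith))
  -- The convex function x log x lies below its chord on [1, 2].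
  have h2 : mulLog (1 + t) ≤ 2 * t := by
    have hc := Real.convexOn_mul_log.2 (Set.mem_Ici.2 zero_le_one) (Set.mem_Ici.2 zero_le_two)
      (sub_nonneg.2 ht1) ht0 (by ring)
    simp only [smul_eq_mul, Real.log_one, mul_zero, zero_add, mul_one] at hc
    have hl : 0 < Real.log 2 := Real.log_pos (by norm_num)
    have : mulLog (1 + t) = (1 + t) * Real.log (1 + t) / Real.log 2 := by
      unfold mulLog Real.logb; ring
    rw [this, div_le_iff₀ hl]
    have e : 1 - t + t * 2 = 1 + t := by ring
    rw [e] at hc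
    linarith
  nlinarith [mul_le_mul_of_nonneg_left h1 hp.le, mul_le_mul_of_nonneg_left h2 hp.le]

/-- Capacity is at most the total variation distance d of the two output laws. The plane vectors
(|W(y|0) - W(y|1)|/2, overlap) have length equal to the output probability, so the triangle
inequality gives d² + Z² ≤ 1. -/
theorem symCap_le_sqrt (W : Channel.{u}) : W.symCap ≤ Real.sqrt (1 - W.bhatt ^ 2) := by
  have hd : ∀ y, mulLog (W.prob 0 y) / 2 + mulLog (W.prob 1 y) / 2 - mulLog (W.outProb y) ≤
      |W.prob 0 y - W.prob 1 y| / 2 := by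
    intro y
    have h0 := W.prob_nonneg 0 y
    have h1 := W.prob_nonneg 1 y
    rcases le_total (W.prob 1 y) (W.prob 0 y) with h | h
    · have := mulLog_add_mulLog_le (p := W.outProb y) (d := (W.prob 0 y - W.prob 1 y) / 2)
        (W.outProb_nonneg y) (by linarith) (by unfold outProb; linarith)
      rw [abs_of_nonneg (by linarith)]
      convert this using 4 <;> · congr 1; unfold outProb; ring
    · have := mulLog_add_mulLog_le (p := W.outProb y) (d := (W.prob 1 y - W.prob 0 y) / 2)
        (W.outProb_nonneg y) (by linarith) (by unfold outProb; linarith)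
      rw [abs_of_nonpos (by linarith), neg_sub, add_comm (mulLog (W.prob 0 y) / 2)]
      convert this using 4 <;> · congr 1; unfold outProb; ring
  have hs : W.symCap ≤ ∑ y, |W.prob 0 y - W.prob 1 y| / 2 := by
    rw [symCap_eq]; exact Finset.sum_le_sum fun y _ => hd y
  refine hs.trans (Real.le_sqrt_of_sq_le ?_)
  have h := sqrt_sum_sq_le Finset.univ (fun y => |W.prob 0 y - W.prob 1 y| / 2) W.overlap
  have e : ∀ y, Real.sqrt ((|W.prob 0 y - W.prob 1 y| / 2) ^ 2 + W.overlap y ^ 2) =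
      W.outProb y := by
    intro y
    rw [overlap_sq, ← Real.sqrt_sq (W.outProb_nonneg y)]
    congr 1
    rw [div_pow, sq_abs]; unfold outProb; ring
  simp only [e, sum_outProb, sum_overlap] at h
  have := (Real.sqrt_le_left (by norm_num)).1 h
  linarith

theorem symCap_le_one (W : Channel.{u}) : W.symCap ≤ 1 :=
  W.symCap_le_sqrt.trans (Real.sqrt_le_one.2 (by linarith [sq_nonneg W.bhatt]))

end Channel

/-! ### The potential f and its contraction -/

theorem fPot_nonneg {b z : ℝ} (h0 : 0 ≤ z) (h1 : z ≤ 1) : 0 ≤ fPot b z :=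
  mul_nonneg (Real.rpow_nonneg h0 _) (Real.rpow_nonneg (sub_nonneg.2 h1) _)

theorem fPot_pos {b z : ℝ} (h0 : 0 < z) (h1 : z < 1) : 0 < fPot b z :=
  mul_pos (Real.rpow_pos_of_pos h0 _) (Real.rpow_pos_of_pos (sub_pos.2 h1) _)

theorem fPot_symm (b z : ℝ) : fPot b (1 - z) = fPot b z := by
  unfold fPot; rw [sub_sub_cancel, mul_comm]

theorem fPot_le_rpow {b z : ℝ} (hb : 0 ≤ b) (h0 : 0 ≤ z) (h1 : z ≤ 1) : fPot b z ≤ z ^ b :=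
  mul_le_of_le_one_right (Real.rpow_nonneg h0 _)
    (Real.rpow_le_one (sub_nonneg.2 h1) (by linarith) hb)

theorem fPot_le_one {b z : ℝ} (hb : 0 ≤ b) (h0 : 0 ≤ z) (h1 : z ≤ 1) : fPot b z ≤ 1 :=
  (fPot_le_rpow hb h0 h1).trans (Real.rpow_le_one h0 h1 hb)

theorem fPot_zero {b : ℝ} (hb : b ≠ 0) : fPot b 0 = 0 := by
  simp [fPot, Real.zero_rpow hb]

theorem fPot_one {b : ℝ} (hb : b ≠ 0) : fPot b 1 = 0 := by
  simp [fPot, Real.zero_rpow hb]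

theorem fPot_le_add {b z₁ z₂ w : ℝ} (hb0 : 0 ≤ b) (hb1 : b ≤ 1) (h₁ : 0 ≤ z₁)
    (h₂ : 0 ≤ z₂) (hw₁ : z₁ ≤ w) (hw₂ : z₂ ≤ w) (hw : w ≤ z₁ + z₂) (hw1 : w ≤ 1) :
    fPot b w ≤ fPot b z₁ + fPot b z₂ := by
  have h : w ^ b ≤ z₁ ^ b + z₂ ^ b :=
    (Real.rpow_le_rpow (h₁.trans hw₁) hw hb0).trans (Real.rpow_add_le_add_rpow h₁ h₂ hb0 hb1)
  have e : 0 ≤ (1 - w) ^ b := Real.rpow_nonneg (by linarith) _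
  have e1 : (1 - w) ^ b ≤ (1 - z₁) ^ b := Real.rpow_le_rpow (by linarith) (by linarith) hb0
  have e2 : (1 - w) ^ b ≤ (1 - z₂) ^ b := Real.rpow_le_rpow (by linarith) (by linarith) hb0
  have f1 := Real.rpow_nonneg h₁ b
  have f2 := Real.rpow_nonneg h₂ b
  unfold fPot
  nlinarith [mul_le_mul_of_nonneg_right h e, mul_le_mul_of_nonneg_left e1 f1,
    mul_le_mul_of_nonneg_left e2 f2]

theorem le_of_mem_minus {z₁ z₂ zm : ℝ} (h₁ : 0 ≤ z₁) (h₁' : z₁ ≤ 1)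
    (h₂ : 0 ≤ z₂) (h₂' : z₂ ≤ 1)
    (hz : zm ∈ Set.Icc (Real.sqrt (z₁ ^ 2 + z₂ ^ 2 - z₁ ^ 2 * z₂ ^ 2)) (z₁ + z₂ - z₁ * z₂)) :
    z₁ ≤ zm ∧ z₂ ≤ zm ∧ zm ≤ z₁ + z₂ ∧ zm ≤ 1 := by
  obtain ⟨hl, hu⟩ := hz
  refine ⟨(Real.le_sqrt_of_sq_le ?_).trans hl, (Real.le_sqrt_of_sq_le ?_).trans hl, ?_, ?_⟩
  · nlinarith [mul_nonneg (sq_nonneg z₂) (by nlinarith : 0 ≤ 1 - z₁ ^ 2)]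
  · nlinarith [mul_nonneg (sq_nonneg z₁) (by nlinarith : 0 ≤ 1 - z₂ ^ 2)]
  · nlinarith [mul_nonneg h₁ h₂]
  · nlinarith [mul_nonneg (sub_nonneg.2 h₁') (sub_nonneg.2 h₂')]

/-- Subadditivity bounds both new values by the old sum: directly for the minus channel and, through
f(1 - z) = f(z), for the plus channel. The crude factor 2 serves to bound the sets whose suprema
define η, since an unbounded set of reals has supremum 0 by convention. -/
theorem fPot_pair_le_two {b z₁ z₂ zm : ℝ} (hb0 : 0 ≤ b) (hb1 : b ≤ 1) (h₁ : 0 ≤ z₁) (h₁' : z₁ ≤ 1)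
    (h₂ : 0 ≤ z₂) (h₂' : z₂ ≤ 1)
    (hz : zm ∈ Set.Icc (Real.sqrt (z₁ ^ 2 + z₂ ^ 2 - z₁ ^ 2 * z₂ ^ 2)) (z₁ + z₂ - z₁ * z₂)) :
    fPot b (z₁ * z₂) + fPot b zm ≤ 2 * (fPot b z₁ + fPot b z₂) := by
  obtain ⟨a1, a2, a3, a4⟩ := le_of_mem_minus h₁ h₁' h₂ h₂' hz
  have hm := fPot_le_add hb0 hb1 h₁ h₂ a1 a2 a3 a4
  have hp := fPot_le_add (z₁ := 1 - z₁) (z₂ := 1 - z₂) (w := 1 - z₁ * z₂) hb0 hb1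
    (by linarith) (by linarith) (by nlinarith) (by nlinarith)
    (by nlinarith [mul_nonneg (sub_nonneg.2 h₁') (sub_nonneg.2 h₂')])
    (by nlinarith [mul_nonneg h₁ h₂])
  simp only [fPot_symm] at hp
  linarith

/-- The range of `z'` in the definition of `h(z)`. -/
def closeRange (c lam z : ℝ) : Set ℝ :=
  if z < c then Set.Icc z (2 * z)
  else if z ≤ 1 - c then Set.Icc z (min (z + lam) (1 - c))
  else Set.Icc z ((1 + z) / 2)

theorem hSup_eq (b c lam z : ℝ) : hSup b c lam z = sSup (gRatio b z '' closeRange c lam z) := by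
  unfold hSup closeRange
  split_ifs <;> rfl

theorem closeRange_subset {c lam z : ℝ} (hc : c ∈ Set.Ioo (0 : ℝ) (1 / 2))
    (hz : z ∈ Set.Ioo (0 : ℝ) 1) : closeRange c lam z ⊆ Set.Ioo 0 1 := by
  obtain ⟨hc0, hc1⟩ := hc
  obtain ⟨hz0, hz1⟩ := hz
  intro w hw
  unfold closeRange at hw
  split_ifs at hw
  · exact ⟨by linarith [hw.1], by linarith [hw.2]⟩
  · exact ⟨by linarith [hw.1], by linarith [hw.2.trans (min_le_right _ _)]⟩
  · exact ⟨by linarith [hw.1], by linarith [hw.2]⟩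

theorem gRatio_image_le_two {b z₁ z₂ : ℝ} (hb0 : 0 ≤ b) (hb1 : b ≤ 1)
    (h₁ : z₁ ∈ Set.Ioo (0 : ℝ) 1) (h₂ : z₂ ∈ Set.Ioo (0 : ℝ) 1) :
    ∀ x ∈ (fun zm => (fPot b (z₁ * z₂) + fPot b zm) / (fPot b z₁ + fPot b z₂)) ''
    Set.Icc (Real.sqrt (z₁ ^ 2 + z₂ ^ 2 - z₁ ^ 2 * z₂ ^ 2)) (z₁ + z₂ - z₁ * z₂), x ≤ 2 := by
  rintro _ ⟨zm, hzm, rfl⟩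
  have h := add_pos (fPot_pos (b := b) h₁.1 h₁.2) (fPot_pos (b := b) h₂.1 h₂.2)
  exact (div_le_iff₀ h).2 (fPot_pair_le_two hb0 hb1 h₁.1.le h₁.2.le h₂.1.le h₂.2.le hzm)

theorem gRatio_le_two {b z₁ z₂ : ℝ} (hb0 : 0 ≤ b) (hb1 : b ≤ 1)
    (h₁ : z₁ ∈ Set.Ioo (0 : ℝ) 1) (h₂ : z₂ ∈ Set.Ioo (0 : ℝ) 1) : gRatio b z₁ z₂ ≤ 2 :=
  Real.sSup_le (gRatio_image_le_two hb0 hb1 h₁ h₂) zero_le_two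

theorem hSup_le_two {b c lam z : ℝ} (hb0 : 0 ≤ b) (hb1 : b ≤ 1)
    (hc : c ∈ Set.Ioo (0 : ℝ) (1 / 2)) (hz : z ∈ Set.Ioo (0 : ℝ) 1) : hSup b c lam z ≤ 2 := by
  rw [hSup_eq]
  refine Real.sSup_le ?_ zero_le_two
  rintro _ ⟨w, hw, rfl⟩
  exact gRatio_le_two hb0 hb1 hz (closeRange_subset hc hz hw)

/-- Pairs of close channels contract the potential by `2^(-η)`. -/
theorem fPot_contraction {b c lam z₁ z₂ zm : ℝ} (hb : b ∈ Set.Ioo (0 : ℝ) 1)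
    (hc : c ∈ Set.Ioo (0 : ℝ) (1 / 2))
    (h₁ : z₁ ∈ Set.Ioo (0 : ℝ) 1) (h₂ : z₂ ∈ closeRange c lam z₁)
    (hz : zm ∈ Set.Icc (Real.sqrt (z₁ ^ 2 + z₂ ^ 2 - z₁ ^ 2 * z₂ ^ 2)) (z₁ + z₂ - z₁ * z₂)) :
    fPot b (z₁ * z₂) + fPot b zm ≤ 2 ^ (-eta b c lam) * (fPot b z₁ + fPot b z₂) := by
  have h₂' := closeRange_subset hc h₁ h₂
  have hpos := add_pos (fPot_pos (b := b) h₁.1 h₁.2) (fPot_pos (b := b) h₂'.1 h₂'.2)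
  rw [← div_le_iff₀ hpos]
  have l1 : (fPot b (z₁ * z₂) + fPot b zm) / (fPot b z₁ + fPot b z₂) ≤ gRatio b z₁ z₂ :=
    le_csSup ⟨2, gRatio_image_le_two hb.1.le hb.2.le h₁ h₂'⟩ ⟨zm, hz, rfl⟩
  have l2 : gRatio b z₁ z₂ ≤ hSup b c lam z₁ := by
    rw [hSup_eq]
    refine le_csSup ⟨2, ?_⟩ ⟨z₂, h₂, rfl⟩
    rintro _ ⟨w, hw, rfl⟩
    exact gRatio_le_two hb.1.le hb.2.le h₁ (closeRange_subset hc h₁ hw)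
  have l3 : hSup b c lam z₁ ≤ sSup (hSup b c lam '' Set.Ioo 0 1) := by
    refine le_csSup ⟨2, ?_⟩ ⟨z₁, h₁, rfl⟩
    rintro _ ⟨w, hw, rfl⟩
    exact hSup_le_two hb.1.le hb.2.le hc hw
  -- Positivity is needed for 2^(-η) to recover the supremum from its logarithm.
  have hS : 0 < sSup (hSup b c lam '' Set.Ioo 0 1) := by
    obtain ⟨q1, q2, _, q3⟩ := le_of_mem_minus h₁.1.le h₁.2.le h₂'.1.le h₂'.2.le hz
    refine lt_of_lt_of_le ?_ ((l1.trans l2).trans l3)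
    refine div_pos (add_pos_of_pos_of_nonneg (fPot_pos (mul_pos h₁.1 h₂'.1) ?_)
      (fPot_nonneg (h₁.1.le.trans q1) q3)) hpos
    nlinarith [h₁.1, h₁.2, h₂'.1, h₂'.2]
  refine ((l1.trans l2).trans l3).trans_eq ?_
  unfold eta
  rw [neg_neg, Real.rpow_logb two_pos (by norm_num) hS]

/-- A monotone function on `[0,1]` whose increments dominate the potential of pairs that are not
close. -/
def gapFn (b c lam z : ℝ) : ℝ :=
  2 / (1 - (1 / 2) ^ b) * (z ^ b - (1 - z) ^ b) + 2 / lam * z + if 1 - c < z then 2 else 0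

theorem one_sub_half_rpow_pos {b : ℝ} (hb : 0 < b) : (0 : ℝ) < 1 - (1 / 2) ^ b :=
  sub_pos.2 (Real.rpow_lt_one (by norm_num) (by norm_num) hb)

theorem gap_parts_mono {b c lam z z' : ℝ} (hb : 0 < b) (hlam : 0 < lam)
    (h0 : 0 ≤ z) (h : z ≤ z') (h1 : z' ≤ 1) :
    z ^ b ≤ z' ^ b ∧ (1 - z') ^ b ≤ (1 - z) ^ b ∧ 2 / lam * z ≤ 2 / lam * z' ∧
      (if 1 - c < z then (2 : ℝ) else 0) ≤ if 1 - c < z' then 2 else 0 := by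
  refine ⟨Real.rpow_le_rpow h0 h hb.le, Real.rpow_le_rpow (by linarith) (by linarith) hb.le,
    mul_le_mul_of_nonneg_left h (by positivity), ?_⟩
  split_ifs <;> linarith

theorem gapFn_mono {b c lam z z' : ℝ} (hb : 0 < b) (hlam : 0 < lam)
    (h0 : 0 ≤ z) (h : z ≤ z') (h1 : z' ≤ 1) : gapFn b c lam z ≤ gapFn b c lam z' := by
  obtain ⟨p1, p2, p3, p4⟩ := gap_parts_mono (c := c) hb hlam h0 h h1
  have hk : 0 ≤ 2 / (1 - (1 / 2 : ℝ) ^ b) := (div_pos two_pos (one_sub_half_rpow_pos hb)).le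
  have := mul_le_mul_of_nonneg_left (by linarith : z ^ b - (1 - z) ^ b ≤ z' ^ b - (1 - z') ^ b) hk
  unfold gapFn; linarith

/-- From x ≤ y/2 follows y^b - x^b ≥ (1 - 2^(-b)) y^b, which explains the leading coefficient in
`gapFn`. -/
theorem two_mul_rpow_le_gap {b x y : ℝ} (hb : 0 < b) (hx : 0 ≤ x) (h : 2 * x ≤ y) :
    2 * y ^ b ≤ 2 / (1 - (1 / 2) ^ b) * (y ^ b - x ^ b) := by
  have hk := one_sub_half_rpow_pos hb
  rw [div_mul_eq_mul_div, le_div_iff₀ hk]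
  have : x ^ b ≤ (1 / 2) ^ b * y ^ b := by
    rw [← Real.mul_rpow (by norm_num) (by linarith)]
    exact Real.rpow_le_rpow hx (by linarith) hb.le
  linarith

/-- Each way of leaving the close range is paid for by one term of `gapFn`: z^b when z' exceeds 2z,
-(1-z)^b when 1 - z' is below (1-z)/2, the linear term for a jump by `lam`, and the indicator for
crossing 1 - c. In the last two cases f ≤ 1 suffices. The endpoints 0 and 1, not covered by η, are
treated separately. -/
theorem contraction_or_gap {b c lam z z' : ℝ} (hb : b ∈ Set.Ioo (0 : ℝ) 1)
    (hc : c ∈ Set.Ioo (0 : ℝ) (1 / 2)) (hlam : 0 < lam)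
    (h0 : 0 ≤ z) (h : z ≤ z') (h1 : z' ≤ 1) :
    (∀ zm ∈ Set.Icc (Real.sqrt (z ^ 2 + z' ^ 2 - z ^ 2 * z' ^ 2)) (z + z' - z * z'),
      fPot b (z * z') + fPot b zm ≤ 2 ^ (-eta b c lam) * (fPot b z + fPot b z')) ∨
    fPot b z + fPot b z' ≤ gapFn b c lam z' - gapFn b c lam z := by
  have hb0 := hb.1
  have hb' := hb0.ne'
  obtain ⟨hc0, hc1⟩ := hc
  rcases h0.eq_or_lt with rfl | hz0
  · rcases h.eq_or_lt with rfl | hz'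
    · left
      intro zm hzm
      obtain rfl : zm = 0 := by
        obtain ⟨p1, p2⟩ := hzm
        norm_num at p1 p2
        linarith
      simp [fPot_zero hb']
    · right
      obtain ⟨p1, p2, p3, p4⟩ := gap_parts_mono (c := c) hb0 hlam h0 h h1
      have hg := two_mul_rpow_le_gap hb0 le_rfl (by linarith : 2 * 0 ≤ z')
      have hf := fPot_le_rpow hb0.le hz'.le h1
      have hk : 0 ≤ 2 / (1 - (1 / 2 : ℝ) ^ b) := (div_pos two_pos (one_sub_half_rpow_pos hb0)).le
      have h5 := mul_nonneg hk (sub_nonneg.2 p2)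
      have h6 := Real.rpow_nonneg hz'.le b
      rw [fPot_zero hb']
      unfold gapFn
      linarith
  by_cases hz1 : z = 1
  · left
    obtain rfl : z' = 1 := le_antisymm h1 (hz1 ▸ h)
    subst hz1
    intro zm hzm
    obtain rfl : zm = 1 := by
      obtain ⟨p1, p2⟩ := hzm
      norm_num at p1 p2
      linarith
    simp [fPot_one hb']
  have hz1 : z < 1 := lt_of_le_of_ne (h.trans h1) hz1
  by_cases hcl : z' ∈ closeRange c lam z
  · exact Or.inl fun zm hzm => fPot_contraction hb ⟨hc0, hc1⟩ ⟨hz0, hz1⟩ hcl hzm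
  right
  obtain ⟨p1, p2, p3, p4⟩ := gap_parts_mono (c := c) hb0 hlam h0 h h1
  have hk : 0 ≤ 2 / (1 - (1 / 2 : ℝ) ^ b) := (div_pos two_pos (one_sub_half_rpow_pos hb0)).le
  have q1 := mul_nonneg hk (sub_nonneg.2 p1)
  have q2 := mul_nonneg hk (sub_nonneg.2 p2)
  have f1 := fPot_le_rpow hb0.le h0 hz1.le
  have f2 := fPot_le_rpow hb0.le (h0.trans h) h1
  unfold closeRange at hcl
  split_ifs at hcl with hca hcb
  · have hlt : 2 * z ≤ z' := by
      by_contra! hh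
      exact hcl ⟨h, hh.le⟩
    have hg := two_mul_rpow_le_gap hb0 h0 hlt
    unfold gapFn; linarith
  · have g1 := fPot_le_one hb0.le h0 hz1.le
    have g2 := fPot_le_one hb0.le (h0.trans h) h1
    by_cases hcross : 1 - c < z'
    · have hs : (if 1 - c < z then (2 : ℝ) else 0) = 0 := if_neg (not_lt.2 hcb)
      have hs' : (if 1 - c < z' then (2 : ℝ) else 0) = 2 := if_pos hcross
      unfold gapFn; rw [hs, hs']; linarith
    · have hlt : z + lam ≤ z' := by
        by_contra! hh
        exact hcl ⟨h, le_min hh.le (not_lt.1 hcross)⟩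
      have hg : 2 / lam * (z' - z) ≥ 2 := by
        rw [ge_iff_le, div_mul_eq_mul_div, le_div_iff₀ hlam]; linarith
      unfold gapFn; linarith
  · have hlt : 2 * (1 - z') ≤ 1 - z := by
      by_contra! hh
      exact hcl ⟨h, by linarith⟩
    have hg := two_mul_rpow_le_gap hb0 (sub_nonneg.2 h1) hlt
    have f3 := fPot_le_rpow hb0.le (sub_nonneg.2 hz1.le) (by linarith)
    have f4 := fPot_le_rpow hb0.le (sub_nonneg.2 h1) (by linarith)
    rw [fPot_symm] at f3 f4
    unfold gapFn; linarith

/-! ### Positions of a block -/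

theorem halves_bijective (m : ℕ) :
    Function.Bijective (Sum.elim (fstHalf (m := m)) (sndHalf (m := m))) := by
  rw [Fintype.bijective_iff_injective_and_card]
  refine ⟨?_, by simp [pow_succ, mul_two]⟩
  rintro (i | i) (j | j) h <;> have hi := i.2 <;> have hj := j.2 <;>
    simp [fstHalf, sndHalf, Fin.ext_iff] at h ⊢ <;> omega

theorem pairs_bijective (m : ℕ) :
    Function.Bijective (Sum.elim (fstOfPair (m := m)) (sndOfPair (m := m))) := by
  rw [Fintype.bijective_iff_injective_and_card]
  refine ⟨?_, by simp [pow_succ, mul_two]⟩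
  rintro (i | i) (j | j) h <;> simp [fstOfPair, sndOfPair, Fin.ext_iff] at h ⊢ <;> omega

theorem sum_halves {m : ℕ} {R : Type*} [AddCommMonoid R] (F : Fin (2 ^ (m + 1)) → R) :
    ∑ p, F p = ∑ i, F (fstHalf i) + ∑ i, F (sndHalf i) := by
  rw [← Fintype.sum_bijective _ (halves_bijective m) _ F fun _ => rfl, Fintype.sum_sum_type]
  rfl

theorem sum_pairs {m : ℕ} {R : Type*} [AddCommMonoid R] (F : Fin (2 ^ (m + 1)) → R) :
    ∑ p, F p = ∑ i, (F (fstOfPair i) + F (sndOfPair i)) := by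
  rw [← Fintype.sum_bijective _ (pairs_bijective m) _ F fun _ => rfl, Fintype.sum_sum_type,
    Finset.sum_add_distrib]
  rfl

theorem joinHalves_fstHalf {α : Type*} {m : ℕ} (a b : Fin (2 ^ m) → α) (i : Fin (2 ^ m)) :
    joinHalves a b (fstHalf i) = a i := by
  simp [joinHalves, fstHalf]

theorem joinHalves_sndHalf {α : Type*} {m : ℕ} (a b : Fin (2 ^ m) → α) (i : Fin (2 ^ m)) :
    joinHalves a b (sndHalf i) = b i := by
  simp [joinHalves, sndHalf]

theorem sum_joinHalves {α R : Type*} [AddCommMonoid R] {m : ℕ} (a b : Fin (2 ^ m) → α)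
    (φ : α → R) : ∑ p, φ (joinHalves a b p) = ∑ i, φ (a i) + ∑ i, φ (b i) := by
  rw [sum_halves]; simp only [joinHalves_fstHalf, joinHalves_sndHalf]

/-! ### Conservation of capacity and unpermuted polarization -/

namespace Polarization

theorem sum_channels_level {R : Type*} [AddCommMonoid R] {m : ℕ}
    (π : Equiv.Perm (Fin (2 ^ (m + 1)))) (T : Fin (2 ^ m) → Bool) (up lo : Polarization m)
    (W : Fin (2 ^ (m + 1)) → Channel.{u}) (φ : Channel.{u} → R) :
    ∑ i, φ ((level π T up lo).channels W i) =
      ∑ i, φ (up.channels (fun i => if T i then W (π (fstOfPair i))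
        else (W (π (fstOfPair i))).minus (W (π (sndOfPair i)))) i) +
      ∑ i, φ (lo.channels (fun i => if T i then W (π (sndOfPair i))
        else (W (π (fstOfPair i))).plus (W (π (sndOfPair i)))) i) :=
  sum_joinHalves _ _ φ

/-- Polarization preserves the total symmetric capacity. -/
theorem sum_symCap_channels : ∀ {m : ℕ} (P : Polarization m) (W : Fin (2 ^ m) → Channel.{u}),
    ∑ i, (P.channels W i).symCap = ∑ i, (W i).symCap
  | _, nil, _ => rfl
  | _, level π T up lo, W => by
    rw [sum_channels_level π T up lo W Channel.symCap, sum_symCap_channels up,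
      sum_symCap_channels lo, ← Equiv.sum_comp π fun i => (W i).symCap, sum_pairs,
      ← Finset.sum_add_distrib]
    refine Finset.sum_congr rfl fun i _ => ?_
    cases T i
    · exact Channel.symCap_minus_add_plus _ _
    · rfl

/-- A permutation of the channels can be absorbed into a polarization. -/
theorem exists_channels_perm : ∀ {m : ℕ} (P : Polarization m) (π : Equiv.Perm (Fin (2 ^ m))),
    ∃ P' : Polarization m, ∀ W : Fin (2 ^ m) → Channel.{u},
      P'.channels W = P.channels fun i => W (π i)
  | _, nil, π => ⟨nil, fun W => by
      have : Subsingleton (Fin (2 ^ 0)) := inferInstanceAs (Subsingleton (Fin 1))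
      funext i
      exact congrArg W (Subsingleton.elim i (π i))⟩
  | _, level π₀ T up lo, π => ⟨level (π₀.trans π) T up lo, fun _ => rfl⟩

/-- `m` levels of unpermuted combinations, followed by levels without combinations. -/
def plain : (M m : ℕ) → Polarization M
  | 0, _ => nil
  | M + 1, 0 => level 1 (fun _ => true) (plain M 0) (plain M 0)
  | M + 1, m + 1 => level 1 (fun _ => false) (plain M m) (plain M m)

theorem sum_plain_zero {R : Type*} [AddCommMonoid R] (φ : Channel.{u} → R) :
    ∀ (M : ℕ) (W : Fin (2 ^ M) → Channel.{u}),
      ∑ i, φ ((plain M 0).channels W i) = ∑ i, φ (W i)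
  | 0, _ => rfl
  | M + 1, W => by
    rw [plain, sum_channels_level, sum_plain_zero φ M, sum_plain_zero φ M, sum_pairs,
      Finset.sum_add_distrib]
    rfl

/-- A bound for unpermuted polarization of consecutive sub-blocks of length `2^m`, the channels of
the `j`-th of which are described by a common state `t j`. -/
theorem sum_plain_le {S : Type*} {Adm : S → Channel.{u} → Prop} {sm sp : S → S} {Φ : ℕ → S → ℝ}
    {φ : Channel.{u} → ℝ} (hm : ∀ s A B, Adm s A → Adm s B → Adm (sm s) (A.minus B))
    (hp : ∀ s A B, Adm s A → Adm s B → Adm (sp s) (A.plus B))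
    (h0 : ∀ s V, Adm s V → φ V ≤ Φ 0 s)
    (hΦ : ∀ m s A, Adm s A → Φ m (sm s) + Φ m (sp s) ≤ 2 * Φ (m + 1) s) :
    ∀ (M m : ℕ), m ≤ M → ∀ (t : ℕ → S) (W : Fin (2 ^ M) → Channel.{u}),
      (∀ i, Adm (t (i.1 / 2 ^ m)) (W i)) →
      ∑ i, φ ((plain M m).channels W i) ≤ ∑ i : Fin (2 ^ M), Φ m (t (i.1 / 2 ^ m))
  | M, 0, _, t, W, hW => by
    rw [sum_plain_zero]
    exact Finset.sum_le_sum fun i _ => h0 _ _ (hW i)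
  | M + 1, m + 1, hmM, t, W, hW => by
    -- Both members of the `i`-th pair lie in the sub-block that becomes, at half length, the
    -- sub-block of position `i` in the next level; the index `i / 2^m` thus survives and only the
    -- state changes.
    have e1 : ∀ i : Fin (2 ^ M), (fstOfPair i).1 / 2 ^ (m + 1) = i.1 / 2 ^ m := fun i => by
      rw [pow_succ' 2 m, ← Nat.div_div_eq_div_mul]; congr 1; simp only [fstOfPair]; omega
    have e2 : ∀ i : Fin (2 ^ M), (sndOfPair i).1 / 2 ^ (m + 1) = i.1 / 2 ^ m := fun i => by
      rw [pow_succ' 2 m, ← Nat.div_div_eq_div_mul]; congr 1; simp only [sndOfPair]; omega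
    have a1 : ∀ i : Fin (2 ^ M), Adm (t (i.1 / 2 ^ m)) (W (fstOfPair i)) := fun i => by
      rw [← e1]; exact hW _
    have a2 : ∀ i : Fin (2 ^ M), Adm (t (i.1 / 2 ^ m)) (W (sndOfPair i)) := fun i => by
      rw [← e2]; exact hW _
    rw [plain, sum_channels_level, sum_pairs]
    refine (add_le_add
      (sum_plain_le hm hp h0 hΦ M m (by omega) (fun j => sm (t j)) _ fun i => hm _ _ _ (a1 i) (a2 i))
      (sum_plain_le hm hp h0 hΦ M m (by omega) (fun j => sp (t j)) _
        fun i => hp _ _ _ (a1 i) (a2 i))).trans ?_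
    rw [← Finset.sum_add_distrib]
    refine Finset.sum_le_sum fun i _ => ?_
    rw [e1, e2, ← two_mul]
    exact hΦ m _ _ (a1 i)

end Polarization

/-! ### Extremal channels -/

/-- The channel is almost noiseless, `Z ≤ x`, or (for `s.1 = true`) almost useless,
`1 - Z² ≤ x`. -/
def IsExtremal (s : Bool × ℝ) (V : Channel.{u}) : Prop :=
  0 ≤ s.2 ∧ if s.1 then 1 - V.bhatt ^ 2 ≤ s.2 else V.bhatt ≤ s.2

/-- The lower bound for Z of the minus channel says that 1 - Z² is submultiplicative there.
Measuring useless channels by 1 - Z² makes the two types exactly dual: here x is doubled or squared,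
and in `isExtremal_plus` the roles are exchanged. -/
theorem isExtremal_minus (s : Bool × ℝ) (A B : Channel.{u}) (hA : IsExtremal s A)
    (hB : IsExtremal s B) :
    IsExtremal (if s.1 then (true, s.2 ^ 2) else (false, 2 * s.2)) (A.minus B) := by
  obtain ⟨_ | _, x⟩ := s
  · obtain ⟨h0, hA⟩ := hA
    obtain ⟨-, hB⟩ := hB
    simp only [IsExtremal, Bool.false_eq_true, if_false] at *
    refine ⟨by linarith, ?_⟩
    have := A.bhatt_minus_le B
    nlinarith [mul_nonneg A.bhatt_nonneg B.bhatt_nonneg]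
  · obtain ⟨h0, hA⟩ := hA
    obtain ⟨-, hB⟩ := hB
    simp only [IsExtremal, if_true] at *
    refine ⟨sq_nonneg _, ?_⟩
    have h := (Real.sqrt_le_left (A.minus B).bhatt_nonneg).1 (A.le_bhatt_minus B)
    have hA0 : 0 ≤ 1 - A.bhatt ^ 2 := by nlinarith [A.bhatt_nonneg, A.bhatt_le_one]
    have hB0 : 0 ≤ 1 - B.bhatt ^ 2 := by nlinarith [B.bhatt_nonneg, B.bhatt_le_one]
    nlinarith [mul_le_mul hA hB hB0 h0]

theorem isExtremal_plus (s : Bool × ℝ) (A B : Channel.{u}) (hA : IsExtremal s A)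
    (hB : IsExtremal s B) :
    IsExtremal (if s.1 then (true, 2 * s.2) else (false, s.2 ^ 2)) (A.plus B) := by
  obtain ⟨_ | _, x⟩ := s
  · obtain ⟨h0, hA⟩ := hA
    obtain ⟨-, hB⟩ := hB
    simp only [IsExtremal, Bool.false_eq_true, if_false] at *
    rw [Channel.bhatt_plus]
    exact ⟨sq_nonneg _, by nlinarith [mul_le_mul hA hB B.bhatt_nonneg h0]⟩
  · obtain ⟨h0, hA⟩ := hA
    obtain ⟨-, hB⟩ := hB
    simp only [IsExtremal, if_true] at *
    rw [Channel.bhatt_plus, mul_pow]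
    have hA0 : 0 ≤ 1 - A.bhatt ^ 2 := by nlinarith [A.bhatt_nonneg, A.bhatt_le_one]
    have hB0 : 0 ≤ 1 - B.bhatt ^ 2 := by nlinarith [B.bhatt_nonneg, B.bhatt_le_one]
    exact ⟨by linarith, by nlinarith [mul_nonneg hA0 hB0]⟩

open Classical in
/-- The capacity of a channel, diminished by `1` if its Bhattacharyya parameter is at most `θ`. -/
def loss (θ : ℝ) (V : Channel.{u}) : ℝ := V.symCap - if V.bhatt ≤ θ then 1 else 0

/-- A bound for the average loss after `m` levels of polarization of `2^m` channels with
`Z ≤ x` or with `1 - Z² ≤ x`. -/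
def lossBound (b s x₀ ρ θ : ℝ) (m : ℕ) (x : ℝ) : ℝ :=
  min 1 ((x / x₀) ^ b + (ρ / 2) ^ m * (x / θ) ^ s)

/-- For x < x₀, the power e of the two new values sums to at most (2^e + x₀^e) x^e; with e = b this
is at most 2 x^b, with e = s at most ρ x^s. For x ≥ x₀ the first summand is already at least 1. The
truncation at 1 thus plays the part of stopping the process when it exceeds x₀. -/
theorem lossBound_step {b s x₀ ρ θ x : ℝ} (hb : 0 < b) (hs : 0 < s) (hx₀ : 0 < x₀)
    (hxb : 2 ^ b + x₀ ^ b ≤ 2) (hxs : 2 ^ s + x₀ ^ s ≤ ρ) (hθ : 0 < θ) (m : ℕ) (hx : 0 ≤ x) :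
    lossBound b s x₀ ρ θ m (2 * x) + lossBound b s x₀ ρ θ m (x ^ 2) ≤
      2 * lossBound b s x₀ ρ θ (m + 1) x := by
  have hρ : 0 ≤ ρ / 2 := by
    have := Real.rpow_nonneg zero_le_two s
    have := Real.rpow_nonneg hx₀.le s
    linarith
  unfold lossBound
  rcases le_or_gt x₀ x with h | h
  · have h1 : 1 ≤ (x / x₀) ^ b + (ρ / 2) ^ (m + 1) * (x / θ) ^ s := by
      have h2 : 1 ≤ (x / x₀) ^ b := Real.one_le_rpow ((one_le_div hx₀).2 h) hb.le
      have h3 : 0 ≤ (ρ / 2) ^ (m + 1) * (x / θ) ^ s :=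
        mul_nonneg (pow_nonneg hρ _) (Real.rpow_nonneg (by positivity) _)
      linarith
    rw [min_eq_left h1]
    linarith [min_le_left (1 : ℝ) ((2 * x / x₀) ^ b + (ρ / 2) ^ m * (2 * x / θ) ^ s),
      min_le_left (1 : ℝ) ((x ^ 2 / x₀) ^ b + (ρ / 2) ^ m * (x ^ 2 / θ) ^ s)]
  · have key : ∀ {e d r : ℝ}, 0 < e → 0 < d → 2 ^ e + x₀ ^ e ≤ r →
        (2 * x / d) ^ e + (x ^ 2 / d) ^ e ≤ r * (x / d) ^ e := by
      intro e d r he hd hr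
      have hxd : 0 ≤ x / d := by positivity
      rw [show 2 * x / d = 2 * (x / d) by ring, show x ^ 2 / d = x * (x / d) by ring,
        Real.mul_rpow two_pos.le hxd, Real.mul_rpow hx hxd, ← add_mul]
      refine mul_le_mul_of_nonneg_right (le_trans ?_ hr) (Real.rpow_nonneg hxd _)
      linarith [Real.rpow_le_rpow hx h.le he.le]
    have k1 := key hb hx₀ hxb
    have k2 := mul_le_mul_of_nonneg_left (key hs hθ hxs) (pow_nonneg hρ m)
    rw [mul_min_of_nonneg _ _ two_pos.le]
    refine le_min ?_ ?_
    · linarith [min_le_left (1 : ℝ) ((2 * x / x₀) ^ b + (ρ / 2) ^ m * (2 * x / θ) ^ s),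
        min_le_left (1 : ℝ) ((x ^ 2 / x₀) ^ b + (ρ / 2) ^ m * (x ^ 2 / θ) ^ s)]
    · rw [pow_succ (ρ / 2)]
      linarith [min_le_right (1 : ℝ) ((2 * x / x₀) ^ b + (ρ / 2) ^ m * (2 * x / θ) ^ s),
        min_le_right (1 : ℝ) ((x ^ 2 / x₀) ^ b + (ρ / 2) ^ m * (x ^ 2 / θ) ^ s)]

theorem loss_le_one (θ : ℝ) (V : Channel.{u}) : loss θ V ≤ 1 := by
  unfold loss
  split_ifs <;> linarith [V.symCap_le_one]

theorem loss_le_lossBound {b s x₀ ρ θ : ℝ} (hs : 0 < s) (hs2 : s ≤ 1 / 2)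
    (hx₀ : 0 < x₀) (hθ : 0 < θ) (hθ1 : θ ≤ 1) (t : Bool × ℝ) (V : Channel.{u})
    (hV : IsExtremal t V) : loss θ V ≤ lossBound b s x₀ ρ θ 0 t.2 := by
  obtain ⟨c, x⟩ := t
  obtain ⟨hx, hV⟩ := hV
  simp only at hx
  have hb0 : 0 ≤ (x / x₀) ^ b := Real.rpow_nonneg (by positivity) _
  have hs0 : 0 ≤ (x / θ) ^ s := Real.rpow_nonneg (by positivity) _
  refine le_min (loss_le_one θ V) ?_
  suffices h : loss θ V ≤ (x / θ) ^ s by simp only [pow_zero, one_mul]; linarith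
  rcases le_total θ x with h | h
  -- For θ ≤ x the right side is at least 1. Otherwise a channel with Z ≤ x ≤ θ has no positive
  -- loss, and one with 1 - Z² ≤ x has capacity at most √x ≤ x^s ≤ (x/θ)^s.
  · exact (loss_le_one θ V).trans (Real.one_le_rpow ((one_le_div hθ).2 h) hs.le)
  cases c
  · simp only [Bool.false_eq_true, if_false] at hV
    unfold loss
    rw [if_pos (hV.trans h)]
    linarith [V.symCap_le_one]
  · simp only [if_true] at hV
    have h1 : loss θ V ≤ V.symCap := by unfold loss; split_ifs <;> linarith
    refine h1.trans (V.symCap_le_sqrt.trans ((Real.sqrt_le_sqrt hV).trans ?_))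
    rcases hx.eq_or_lt with rfl | hx
    · simpa using hs0
    rw [Real.sqrt_eq_rpow]
    refine (Real.rpow_le_rpow_of_exponent_ge hx (h.trans hθ1) hs2).trans ?_
    refine Real.rpow_le_rpow hx.le ?_ hs.le
    rw [le_div_iff₀ hθ]
    exact mul_le_of_le_one_right hx.le hθ1

theorem sum_loss_plain_le {b s x₀ ρ θ : ℝ} (hb : 0 < b) (hs : 0 < s) (hs2 : s ≤ 1 / 2)
    (hx₀ : 0 < x₀) (hxb : 2 ^ b + x₀ ^ b ≤ 2) (hxs : 2 ^ s + x₀ ^ s ≤ ρ) (hθ : 0 < θ)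
    (hθ1 : θ ≤ 1) {M m : ℕ} (hmM : m ≤ M) (t : ℕ → Bool × ℝ) (W : Fin (2 ^ M) → Channel.{u})
    (hW : ∀ i, IsExtremal (t (i.1 / 2 ^ m)) (W i)) :
    ∑ i, loss θ ((Polarization.plain M m).channels W i) ≤
      ∑ i : Fin (2 ^ M), lossBound b s x₀ ρ θ m (t (i.1 / 2 ^ m)).2 := by
  refine Polarization.sum_plain_le (Φ := fun m t => lossBound b s x₀ ρ θ m t.2)
    isExtremal_minus isExtremal_plus (loss_le_lossBound hs hs2 hx₀ hθ hθ1) ?_ M m hmM t W hW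
  rintro m ⟨_ | _, x⟩ A ⟨hx, -⟩
  · exact lossBound_step hb hs hx₀ hxb hxs hθ m hx
  · rw [add_comm]; exact lossBound_step hb hs hx₀ hxb hxs hθ m hx

/-! ### Sorted blocks -/

theorem sum_range_mul_div {R : Type*} [AddCommMonoid R] (G : ℕ → R) {q : ℕ} (hq : 0 < q) (a : ℕ) :
    ∑ i ∈ Finset.range (a * q), G (i / q) = q • ∑ j ∈ Finset.range a, G j := by
  induction a with
  | zero => simp
  | succ a ih =>
    rw [Nat.succ_mul, Finset.sum_range_add, ih, Finset.sum_range_succ, nsmul_add]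
    congr 1
    rw [Finset.sum_congr rfl (g := fun _ => G a), Finset.sum_const, Finset.card_range]
    intro i hi
    rw [mul_comm, Nat.mul_add_div hq, Nat.div_eq_of_lt (Finset.mem_range.1 hi), add_zero]

/-- A monotone function on `[0,1]` whose increments account for sub-blocks of a sorted block with
very different channels. -/
def spreadFn (b z : ℝ) : ℝ := z ^ b - (1 - z ^ 2) ^ b + if 1 / 2 < z then 1 else 0

theorem spread_parts_mono {b z z' : ℝ} (hb : 0 < b) (h0 : 0 ≤ z) (h : z ≤ z') (h1 : z' ≤ 1) :
    z ^ b ≤ z' ^ b ∧ (1 - z' ^ 2) ^ b ≤ (1 - z ^ 2) ^ b ∧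
      (if 1 / 2 < z then (1 : ℝ) else 0) ≤ if 1 / 2 < z' then 1 else 0 := by
  refine ⟨Real.rpow_le_rpow h0 h hb.le, Real.rpow_le_rpow (by nlinarith) (by nlinarith) hb.le, ?_⟩
  split_ifs <;> linarith

theorem spreadFn_mono {b z z' : ℝ} (hb : 0 < b) (h0 : 0 ≤ z) (h : z ≤ z') (h1 : z' ≤ 1) :
    spreadFn b z ≤ spreadFn b z' := by
  obtain ⟨p1, p2, p3⟩ := spread_parts_mono hb h0 h h1
  unfold spreadFn; linarith

/-- The common state of channels with Bhattacharyya parameters in `[z₀, z₁]`. -/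
def rangeState (z₀ z₁ : ℝ) : Bool × ℝ :=
  if z₁ ≤ 1 / 2 then (false, z₁) else if 1 / 2 ≤ z₀ then (true, 1 - z₀ ^ 2) else (false, 1)

theorem isExtremal_rangeState {z₀ z₁ : ℝ} (V : Channel.{u}) (h0 : 0 ≤ z₀) (h : z₀ ≤ V.bhatt)
    (h' : V.bhatt ≤ z₁) : IsExtremal (rangeState z₀ z₁) V := by
  unfold rangeState
  split_ifs with h1 h2
  · exact ⟨V.bhatt_nonneg.trans h', h'⟩
  · exact ⟨by nlinarith [V.bhatt_le_one], by simp only [if_true]; nlinarith⟩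
  · exact ⟨zero_le_one, V.bhatt_le_one⟩

theorem rangeState_mem {z₀ z₁ : ℝ} (h0 : 0 ≤ z₀) (h : z₀ ≤ z₁) (h1 : z₁ ≤ 1) :
    0 ≤ (rangeState z₀ z₁).2 ∧ (rangeState z₀ z₁).2 ≤ 1 := by
  unfold rangeState
  split_ifs
  · exact ⟨by simp only []; linarith, h1⟩
  · exact ⟨by simp only []; nlinarith, by simp only []; nlinarith⟩
  · exact ⟨zero_le_one, le_rfl⟩

theorem half_le_rpow {b z : ℝ} (hb : b ∈ Set.Ioo (0 : ℝ) 1) (hz : 1 / 2 ≤ z) :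
    1 / 2 ≤ z ^ b := by
  have h1 : (1 / 2 : ℝ) ≤ (1 / 2) ^ b := by
    conv_lhs => rw [← Real.rpow_one (1 / 2 : ℝ)]
    exact Real.rpow_le_rpow_of_exponent_ge (by norm_num) (by norm_num) hb.2.le
  exact h1.trans (Real.rpow_le_rpow (by norm_num) hz hb.1.le)

/-- If the range lies on one side of 1/2, the extreme value differs from the value at z by an
increment of `spreadFn`, and the value at z is at most 4 f(z), because the other factor of f is at
least 1/2 and (1+z)^b ≤ 2. A range straddling 1/2 has the trivial state 1, paid for by the jump of
the indicator. -/
theorem rangeState_rpow_le {b z₀ z z₁ : ℝ} (hb : b ∈ Set.Ioo (0 : ℝ) 1) (h0 : 0 ≤ z₀)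
    (h : z₀ ≤ z) (h' : z ≤ z₁) (h1 : z₁ ≤ 1) :
    (rangeState z₀ z₁).2 ^ b ≤ 4 * fPot b z + (spreadFn b z₁ - spreadFn b z₀) := by
  obtain ⟨p1, p2, p3⟩ := spread_parts_mono hb.1 h0 h (h'.trans h1)
  obtain ⟨q1, q2, q3⟩ := spread_parts_mono hb.1 (h0.trans h) h' h1
  have hz0 := h0.trans h
  have hz1 := h'.trans h1
  have hf := fPot_nonneg (b := b) hz0 hz1
  have n1 := Real.rpow_nonneg hz0 b
  have n2 := Real.rpow_nonneg (sub_nonneg.2 hz1) b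
  unfold rangeState
  split_ifs with c1 c2
  · have hh := half_le_rpow (z := 1 - z) hb (by linarith)
    have : z ^ b ≤ 4 * fPot b z := by
      unfold fPot; nlinarith [mul_le_mul_of_nonneg_left hh n1]
    unfold spreadFn; simp only []; linarith
  · have hh := half_le_rpow (z := z) hb (by linarith)
    have h2 : (1 + z) ^ b ≤ 2 := by
      calc (1 + z) ^ b ≤ (1 + z) ^ (1 : ℝ) :=
            Real.rpow_le_rpow_of_exponent_le (by linarith) hb.2.le
        _ ≤ 2 := by rw [Real.rpow_one]; linarith
    have : (1 - z ^ 2) ^ b ≤ 4 * fPot b z := by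
      rw [show 1 - z ^ 2 = (1 - z) * (1 + z) by ring,
        Real.mul_rpow (sub_nonneg.2 hz1) (by linarith)]
      unfold fPot
      nlinarith [mul_le_mul_of_nonneg_left hh n2, mul_le_mul_of_nonneg_left h2 n2]
    unfold spreadFn; simp only []; linarith
  · have e1 : (if 1 / 2 < z₁ then (1 : ℝ) else 0) = 1 := if_pos (not_le.1 c1)
    have e0 : (if 1 / 2 < z₀ then (1 : ℝ) else 0) = 0 := if_neg (by linarith)
    simp only [Real.one_rpow]
    unfold spreadFn; rw [e1, e0]; linarith

theorem spreadFn_one_sub_zero {b : ℝ} (hb : 0 < b) : spreadFn b 1 - spreadFn b 0 = 3 := by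
  unfold spreadFn
  rw [if_pos (by norm_num), if_neg (by norm_num)]
  norm_num [Real.zero_rpow hb.ne']

theorem sum_fin_pow {R : Type*} [AddCommMonoid R] {M m : ℕ} (hmM : m ≤ M) (G : ℕ → R) :
    ∑ i : Fin (2 ^ M), G (i.1 / 2 ^ m) = 2 ^ m • ∑ j ∈ Finset.range (2 ^ (M - m)), G j := by
  rw [Fin.sum_univ_eq_sum_range (fun i => G (i / 2 ^ m)), ← sum_range_mul_div G (by positivity),
    ← pow_add, Nat.sub_add_cancel hmM]

/-- Telescoping over consecutive sub-blocks of a sorted sequence. -/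
theorem sum_increments_le {z : ℕ → ℝ} (hz : Monotone z) (h0 : ∀ i, 0 ≤ z i) (h1 : ∀ i, z i ≤ 1)
    {ψ : ℝ → ℝ} (hψ : ∀ x y, 0 ≤ x → x ≤ y → y ≤ 1 → ψ x ≤ ψ y) {q : ℕ} (hq : 0 < q) (a : ℕ) :
    ∑ j ∈ Finset.range a, (ψ (z (j * q + (q - 1))) - ψ (z (j * q))) ≤ ψ 1 - ψ 0 := by
  calc ∑ j ∈ Finset.range a, (ψ (z (j * q + (q - 1))) - ψ (z (j * q)))
      ≤ ∑ j ∈ Finset.range a, (ψ (z ((j + 1) * q)) - ψ (z (j * q))) := by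
        refine Finset.sum_le_sum fun j _ => sub_le_sub_right (hψ _ _ (h0 _) (hz ?_) (h1 _)) _
        rw [Nat.succ_mul]; omega
    _ = ψ (z (a * q)) - ψ (z (0 * q)) := Finset.sum_range_sub (fun j => ψ (z (j * q))) a
    _ ≤ ψ 1 - ψ 0 := sub_le_sub (hψ _ _ (h0 _) (h1 _) le_rfl)
        (hψ _ _ le_rfl (h0 _) (h1 _))

/-- The channels of a block can be sorted by Bhattacharyya parameter. -/
theorem exists_sorted {M : ℕ} (W : Fin (2 ^ M) → Channel.{u}) :
    ∃ (π : Equiv.Perm (Fin (2 ^ M))) (z : ℕ → ℝ), Monotone z ∧ (∀ i, 0 ≤ z i) ∧ (∀ i, z i ≤ 1) ∧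
      ∀ i : Fin (2 ^ M), (W (π i)).bhatt = z i := by
  have hp : 0 < 2 ^ M := by positivity
  refine ⟨Tuple.sort fun i => (W i).bhatt,
    -- The sorted values are continued by the last one, to give a monotone sequence on ℕ.
    fun i => (W (Tuple.sort (fun i => (W i).bhatt) ⟨min i (2 ^ M - 1), by omega⟩)).bhatt,
    fun i j hij => ?_, fun _ => Channel.bhatt_nonneg _, fun _ => Channel.bhatt_le_one _,
    fun i => ?_⟩
  · exact Tuple.monotone_sort (fun i => (W i).bhatt)
      (Fin.mk_le_mk.2 (min_le_min_right _ hij))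
  · congr 4
    have := i.2
    exact Fin.ext (by simp only []; omega)

/-- In the bound, 3 is the total increase of `spreadFn` over [0, 1]; each sub-block spread is
counted once for each of its 2^m channels. -/
theorem exists_sum_loss_le_of_block {b s x₀ ρ θ : ℝ} (hb : b ∈ Set.Ioo (0 : ℝ) 1) (hs : 0 < s)
    (hs2 : s ≤ 1 / 2) (hx₀ : 0 < x₀) (hxb : 2 ^ b + x₀ ^ b ≤ 2) (hxs : 2 ^ s + x₀ ^ s ≤ ρ)
    (hθ : 0 < θ) (hθ1 : θ ≤ 1) {M m : ℕ} (hmM : m ≤ M) (W : Fin (2 ^ M) → Channel.{u}) :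
    ∃ P : Polarization M, ∑ i, loss θ (P.channels W i) ≤
      (1 / x₀) ^ b * (4 * ∑ i, fPot b (W i).bhatt + 3 * 2 ^ m) +
        2 ^ M * ((ρ / 2) ^ m * (1 / θ) ^ s) := by
  obtain ⟨π, z, hz, hz0, hz1, hW⟩ := exists_sorted W
  obtain ⟨P, hP⟩ := Polarization.exists_channels_perm.{u} (Polarization.plain M m) π
  have hq : 0 < 2 ^ m := by positivity
  have hρ : 0 ≤ ρ / 2 := by
    have := Real.rpow_nonneg zero_le_two s
    have := Real.rpow_nonneg hx₀.le s
    linarith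
  set t : ℕ → Bool × ℝ := fun j => rangeState (z (j * 2 ^ m)) (z (j * 2 ^ m + (2 ^ m - 1))) with ht
  have hlo : ∀ i, z (i / 2 ^ m * 2 ^ m) ≤ z i := fun i => hz (Nat.div_mul_le_self _ _)
  have hhi : ∀ i, z i ≤ z (i / 2 ^ m * 2 ^ m + (2 ^ m - 1)) := fun i => hz (by
    have h1 := Nat.div_add_mod i (2 ^ m)
    have h2 := Nat.mod_lt i hq
    rw [mul_comm] at h1
    omega)
  refine ⟨P, ?_⟩
  rw [hP]
  refine (sum_loss_plain_le hb.1 hs hs2 hx₀ hxb hxs hθ hθ1 hmM t _ fun i =>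
    isExtremal_rangeState _ (hz0 _) ((hlo i).trans_eq (hW i).symm)
      ((hW i).trans_le (hhi i))).trans ?_
  have hterm : ∀ i : Fin (2 ^ M), lossBound b s x₀ ρ θ m (t (i.1 / 2 ^ m)).2 ≤
      (1 / x₀) ^ b * (4 * fPot b (W (π i)).bhatt +
        (spreadFn b (z (i.1 / 2 ^ m * 2 ^ m + (2 ^ m - 1))) -
          spreadFn b (z (i.1 / 2 ^ m * 2 ^ m)))) + (ρ / 2) ^ m * (1 / θ) ^ s := by
    intro i
    obtain ⟨t0, t1⟩ := rangeState_mem (hz0 _) ((hlo i).trans (hhi i)) (hz1 _)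
    refine (min_le_right _ _).trans (add_le_add ?_ ?_)
    · rw [div_eq_mul_one_div, mul_comm, Real.mul_rpow (by positivity) t0]
      refine mul_le_mul_of_nonneg_left ?_ (by positivity)
      rw [hW]
      exact rangeState_rpow_le hb (hz0 _) (hlo i) (hhi i) (hz1 _)
    · refine mul_le_mul_of_nonneg_left (Real.rpow_le_rpow (by positivity) ?_ hs.le)
        (pow_nonneg hρ _)
      exact div_le_div_of_nonneg_right t1 hθ.le
  refine (Finset.sum_le_sum fun i _ => hterm i).trans ?_
  rw [Finset.sum_add_distrib, ← Finset.mul_sum, Finset.sum_add_distrib, ← Finset.mul_sum,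
    Equiv.sum_comp π fun i => fPot b (W i).bhatt,
    sum_fin_pow hmM fun j => spreadFn b (z (j * 2 ^ m + (2 ^ m - 1))) - spreadFn b (z (j * 2 ^ m)),
    Finset.sum_const, Finset.card_univ, Fintype.card_fin, nsmul_eq_mul, nsmul_eq_mul]
  push_cast
  have hinc := sum_increments_le hz hz0 hz1 (fun x y => spreadFn_mono (b := b) hb.1) hq
    (2 ^ (M - m))
  rw [spreadFn_one_sub_zero hb.1] at hinc
  have h3 := mul_le_mul_of_nonneg_left hinc (by positivity : (0 : ℝ) ≤ 2 ^ m)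
  have h4 : 0 ≤ (1 / x₀) ^ b := by positivity
  linarith [mul_le_mul_of_nonneg_left h3 h4]

/-- `k` levels with sorting, in which pairs of very different channels are skipped, followed by
unpermuted polarization of sorted sub-blocks of length `2^m`. -/
theorem exists_sum_loss_le {b c lam s x₀ ρ θ : ℝ} (hb : b ∈ Set.Ioo (0 : ℝ) 1)
    (hc : c ∈ Set.Ioo (0 : ℝ) (1 / 2)) (hlam : 0 < lam) (heta : 0 < eta b c lam) (hs : 0 < s)
    (hs2 : s ≤ 1 / 2) (hx₀ : 0 < x₀) (hxb : 2 ^ b + x₀ ^ b ≤ 2) (hxs : 2 ^ s + x₀ ^ s ≤ ρ)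
    (hθ : 0 < θ) (hθ1 : θ ≤ 1) (m : ℕ) :
    ∀ (k M : ℕ), k + m ≤ M → ∀ W : Fin (2 ^ M) → Channel.{u},
    ∃ P : Polarization M, ∑ i, loss θ (P.channels W i) ≤
      4 * (1 / x₀) ^ b * (2 ^ (-eta b c lam)) ^ k * ∑ i, fPot b (W i).bhatt +
      (2 ^ k * (3 * (1 / x₀) ^ b * 2 ^ m +
        4 * (1 / x₀) ^ b * (gapFn b c lam 1 - gapFn b c lam 0)) -
          4 * (1 / x₀) ^ b * (gapFn b c lam 1 - gapFn b c lam 0)) +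
        2 ^ M * ((ρ / 2) ^ m * (1 / θ) ^ s)
  -- The additive term solves e(k+1) = 2 e(k) + D with D = 4 (1/x₀)^b g, where g is the increase of
  -- `gapFn` over [0, 1]: two half-length blocks, and one telescoped gap for the present level,
  -- whose damping r^k ≤ 1 is dropped.
  | 0, M, hM, W => by
    obtain ⟨P, hP⟩ := exists_sum_loss_le_of_block hb hs hs2 hx₀ hxb hxs hθ hθ1
      (by omega : m ≤ M) W
    exact ⟨P, hP.trans_eq (by ring)⟩
  | k + 1, 0, hM, W => by omega
  | k + 1, M + 1, hM, W => by
    classical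
    obtain ⟨π, z, hz, hz0, hz1, hW⟩ := exists_sorted W
    set A := fun i : Fin (2 ^ M) => W (π (fstOfPair i)) with hA
    set B := fun i : Fin (2 ^ M) => W (π (sndOfPair i)) with hB
    set r : ℝ := 2 ^ (-eta b c lam) with hr
    set g := gapFn b c lam 1 - gapFn b c lam 0 with hg
    -- The skipping rule tests contraction itself, not closeness; by `contraction_or_gap` every
    -- skipped pair then has a large gap.
    set T : Fin (2 ^ M) → Bool := fun i => decide
      (¬ fPot b ((A i).minus (B i)).bhatt + fPot b ((A i).plus (B i)).bhatt ≤
        r * (fPot b (A i).bhatt + fPot b (B i).bhatt)) with hT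
    set U : Fin (2 ^ M) → Channel.{u} := fun i => if T i then A i else (A i).minus (B i) with hU
    set V : Fin (2 ^ M) → Channel.{u} := fun i => if T i then B i else (A i).plus (B i) with hV
    obtain ⟨Pu, hPu⟩ := exists_sum_loss_le hb hc hlam heta hs hs2 hx₀ hxb hxs hθ hθ1 m k M
      (by omega) U
    obtain ⟨Pl, hPl⟩ := exists_sum_loss_le hb hc hlam heta hs hs2 hx₀ hxb hxs hθ hθ1 m k M
      (by omega) V
    refine ⟨.level π T Pu Pl, ?_⟩
    rw [Polarization.sum_channels_level]
    have hr1 : r ≤ 1 := Real.rpow_le_one_of_one_le_of_nonpos one_le_two (by linarith)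
    have hr0 : 0 ≤ r := by positivity
    have hfn : ∀ V : Channel.{u}, 0 ≤ fPot b V.bhatt := fun V =>
      fPot_nonneg V.bhatt_nonneg V.bhatt_le_one
    have hzA : ∀ i, (A i).bhatt = z (i.1 * 2) := fun i => by
      rw [mul_comm]; exact hW (fstOfPair i)
    have hzB : ∀ i, (B i).bhatt = z (i.1 * 2 + 1) := fun i => by
      rw [mul_comm]; exact hW (sndOfPair i)
    have hpair : ∀ i, fPot b (U i).bhatt + fPot b (V i).bhatt ≤
        r * (fPot b (A i).bhatt + fPot b (B i).bhatt) +
          (gapFn b c lam (z (i.1 * 2 + (2 - 1))) - gapFn b c lam (z (i.1 * 2))) := by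
      intro i
      have hmono := gapFn_mono (c := c) hb.1 hlam (hz0 (i.1 * 2))
        (hz (by omega : i.1 * 2 ≤ i.1 * 2 + (2 - 1))) (hz1 _)
      by_cases hcon : fPot b ((A i).minus (B i)).bhatt + fPot b ((A i).plus (B i)).bhatt ≤
        r * (fPot b (A i).bhatt + fPot b (B i).bhatt)
      · have hTi : T i = false := by simp [hT, hcon]
        simp only [hU, hV, hTi, Bool.false_eq_true, if_false]
        linarith
      · have hTi : T i = true := by simpa [hT] using hcon
        simp only [hU, hV, hTi, if_true]
        have h2 := mul_nonneg hr0 (add_nonneg (hfn (A i)) (hfn (B i)))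
        rcases contraction_or_gap hb hc hlam (hz0 (i.1 * 2))
          (hz (by omega : i.1 * 2 ≤ i.1 * 2 + 1)) (hz1 _) with h | h
        · refine absurd ?_ hcon
          have := h ((A i).minus (B i)).bhatt (by
            rw [← hzA, ← hzB]
            exact ⟨Channel.le_bhatt_minus _ _, Channel.bhatt_minus_le _ _⟩)
          rw [← hzA, ← hzB, ← Channel.bhatt_plus] at this
          linarith
        · rw [← hzA, ← hzB] at h
          simp only [Nat.add_one_sub_one, ← hzA, ← hzB]
          linarith
    have hsum : ∑ i, fPot b (U i).bhatt + ∑ i, fPot b (V i).bhatt ≤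
        r * ∑ i, fPot b (W i).bhatt + g := by
      rw [← Finset.sum_add_distrib, ← Equiv.sum_comp π fun i => fPot b (W i).bhatt, sum_pairs]
      refine (Finset.sum_le_sum fun i _ => hpair i).trans ?_
      rw [Finset.sum_add_distrib, ← Finset.mul_sum]
      gcongr
      rw [Fin.sum_univ_eq_sum_range fun j =>
        gapFn b c lam (z (j * 2 + (2 - 1))) - gapFn b c lam (z (j * 2))]
      exact sum_increments_le hz hz0 hz1 (fun x y => gapFn_mono (c := c) hb.1 hlam) two_pos _
    have hg0 : 0 ≤ g := sub_nonneg.2 (gapFn_mono hb.1 hlam le_rfl zero_le_one le_rfl)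
    have ha : 0 ≤ 4 * (1 / x₀) ^ b := by positivity
    have hrk0 : 0 ≤ r ^ k := pow_nonneg hr0 k
    have hrk1 : r ^ k ≤ 1 := pow_le_one₀ hr0 hr1
    refine (add_le_add hPu hPl).trans ?_
    have e1 := mul_le_mul_of_nonneg_left hsum (mul_nonneg ha hrk0)
    have e2 : 4 * (1 / x₀) ^ b * r ^ k * g ≤ 4 * (1 / x₀) ^ b * g :=
      mul_le_mul_of_nonneg_right (mul_le_of_le_one_right ha hrk1) hg0
    rw [pow_succ r, pow_succ (2 : ℝ) k, pow_succ (2 : ℝ) M]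
    linarith

open Channel (sum_zmod_two)

/-! ### The law of the bit-channels -/

theorem prod_pairs {m : ℕ} {R : Type*} [CommMonoid R] (F : Fin (2 ^ (m + 1)) → R) :
    ∏ p, F p = ∏ i, (F (fstOfPair i) * F (sndOfPair i)) := by
  rw [← Fintype.prod_bijective _ (pairs_bijective m) _ F fun _ => rfl, Fintype.prod_sum_type,
    Finset.prod_mul_distrib]
  rfl

theorem joinPairs_fstOfPair {α : Type*} {m : ℕ} (a b : Fin (2 ^ m) → α) (i : Fin (2 ^ m)) :
    joinPairs a b (fstOfPair i) = a i := by
  simp [joinPairs, fstOfPair]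

theorem joinPairs_sndOfPair {α : Type*} {m : ℕ} (a b : Fin (2 ^ m) → α) (i : Fin (2 ^ m)) :
    joinPairs a b (sndOfPair i) = b i := by
  have h : (2 * i.1 + 1) / 2 = i.1 := by omega
  simp [joinPairs, sndOfPair, Nat.add_mod, h]

theorem sum_split_word {m : ℕ} (H : (Fin (2 ^ m) → ZMod 2) → (Fin (2 ^ m) → ZMod 2) → ℝ) :
    ∑ x : Fin (2 ^ (m + 1)) → ZMod 2, H (fun i => x (fstHalf i)) (fun i => x (sndHalf i)) =
      ∑ x, ∑ x', H x x' := by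
  rw [← Fintype.sum_prod_type']
  refine Fintype.sum_bijective (fun x : Fin (2 ^ (m + 1)) → ZMod 2 =>
    ((fun i => x (fstHalf i)), (fun i => x (sndHalf i)))) ?_ _ _ fun _ => rfl
  rw [Fintype.bijective_iff_injective_and_card]
  constructor
  · intro x y h
    obtain ⟨h1, h2⟩ := Prod.ext_iff.1 h
    funext p
    obtain ⟨q | q, rfl⟩ := (halves_bijective m).2 p
    · exact congrFun h1 q
    · exact congrFun h2 q
  · simp only [Fintype.card_prod, Fintype.card_fun, Fintype.card_fin, pow_succ, mul_two, pow_add]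

theorem sum_split_outputs {m : ℕ} (π : Equiv.Perm (Fin (2 ^ (m + 1))))
    (W : Fin (2 ^ (m + 1)) → Channel.{u})
    (H : (∀ i, (W (π (fstOfPair i))).Out × (W (π (sndOfPair i))).Out) → ℝ) :
    ∑ y : ∀ j, (W j).Out, H (fun i => (y (π (fstOfPair i)), y (π (sndOfPair i)))) = ∑ y, H y := by
  refine Fintype.sum_bijective (fun (y : ∀ j, (W j).Out) i =>
    (y (π (fstOfPair i)), y (π (sndOfPair i)))) ?_ _ _ fun _ => rfl
  rw [Fintype.bijective_iff_injective_and_card]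
  constructor
  · intro x y h
    funext p
    obtain ⟨p, rfl⟩ := π.surjective p
    obtain ⟨q | q, rfl⟩ := (pairs_bijective m).2 p
    · exact congrArg Prod.fst (congrFun h q)
    · exact congrArg Prod.snd (congrFun h q)
  · simp only [Fintype.card_pi, Fintype.card_prod]
    rw [← Equiv.prod_comp π, prod_pairs]

/-- Push-forward of a product of kernels under a product of maps. -/
theorem sum_prod_map {ι : Type*} [Fintype ι] [DecidableEq ι] {X Y : ι → Type*}
    [∀ i, Fintype (X i)] [∀ i, Fintype (Y i)] (g : ∀ i, X i → Y i) (κ : ∀ i, X i → ℝ)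
    (ν : ∀ i, Y i → ℝ)
    (h : ∀ i (φ : Y i → ℝ), ∑ x, κ i x * φ (g i x) = ∑ y, ν i y * φ y)
    (G : (∀ i, Y i) → ℝ) :
    ∑ x : ∀ i, X i, (∏ i, κ i (x i)) * G (fun i => g i (x i)) =
      ∑ y : ∀ i, Y i, (∏ i, ν i (y i)) * G y := by
  classical
  -- Testing against indicators identifies each ν as a push-forward pointwise.
  have e : ∀ (i : ι) (o : Y i), ν i o = ∑ x, κ i x * if o = g i x then 1 else 0 := by
    intro i o
    rw [h i fun y => if o = y then 1 else 0]
    simp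
  have e2 : ∀ y : ∀ i, Y i, ∏ i, ν i (y i) =
      ∑ x : ∀ i, X i, (∏ i, κ i (x i)) * if y = (fun i => g i (x i)) then 1 else 0 := by
    intro y
    rw [Finset.prod_congr rfl fun i _ => e i (y i), Finset.prod_univ_sum, Fintype.piFinset_univ]
    refine Finset.sum_congr rfl fun x _ => ?_
    rw [Finset.prod_mul_distrib]
    congr 1
    by_cases hy : y = fun i => g i (x i)
    · rw [if_pos hy]
      exact Finset.prod_eq_one fun i _ => if_pos (congrFun hy i)
    · rw [if_neg hy]
      obtain ⟨i, hi⟩ := Function.ne_iff.1 hy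
      exact Finset.prod_eq_zero (Finset.mem_univ i) (if_neg hi)
  simp only [e2, Finset.sum_mul]
  rw [Finset.sum_comm]
  refine Finset.sum_congr rfl fun x _ => ?_
  simp

/-- The output of the first channel contributed by a pair, as a function of the outputs of the
pair. -/
def upperOut : (t : Bool) → (A B : Channel.{u}) → A.Out × B.Out →
    (if t then A else A.minus B).Out
  | true, _, _, y => y.1
  | false, _, _, y => y

/-- The output of the second channel contributed by a pair, as a function of the outputs of the
pair and of the input of the first contributed channel. -/
def lowerOut : (t : Bool) → (A B : Channel.{u}) → (A.Out × B.Out) × ZMod 2 →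
    (if t then B else A.plus B).Out
  | true, _, _, y => y.1.2
  | false, _, _, y => y

/-- The factor 2 appears because the second input is summed, not averaged; for a skipped pair the
output of `B` is summed out. In `sum_lowerOut` the first input is part of the observation, and 2
arises likewise. -/
theorem sum_upperOut (t : Bool) (A B : Channel.{u}) (a : ZMod 2)
    (φ : (if t then A else A.minus B).Out → ℝ) :
    ∑ y : A.Out × B.Out, (∑ β, A.prob (if t then a else a + β) y.1 * B.prob β y.2) *
        φ (upperOut t A B y) =
      ∑ o, 2 * (if t then A else A.minus B).prob a o * φ o := by
  cases t
  · change ∑ y : A.Out × B.Out, (∑ β, A.prob (a + β) y.1 * B.prob β y.2) * φ y =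
      ∑ y : A.Out × B.Out, 2 * ((1 / 2) * ∑ β, A.prob (a + β) y.1 * B.prob β y.2) * φ y
    refine Finset.sum_congr rfl fun y _ => ?_
    ring
  · change ∑ y : A.Out × B.Out, (∑ β, A.prob a y.1 * B.prob β y.2) * φ y.1 =
      ∑ y : A.Out, 2 * A.prob a y * φ y
    rw [Fintype.sum_prod_type]
    refine Finset.sum_congr rfl fun y _ => ?_
    simp only [sum_zmod_two, ← Finset.sum_mul, Finset.sum_add_distrib, ← Finset.mul_sum,
      B.prob_sum]
    ring

theorem sum_lowerOut (t : Bool) (A B : Channel.{u}) (β : ZMod 2)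
    (φ : (if t then B else A.plus B).Out → ℝ) :
    ∑ y : (A.Out × B.Out) × ZMod 2,
        (A.prob (if t then y.2 else y.2 + β) y.1.1 * B.prob β y.1.2) * φ (lowerOut t A B y) =
      ∑ o, 2 * (if t then B else A.plus B).prob β o * φ o := by
  cases t
  · change ∑ y : (A.Out × B.Out) × ZMod 2, (A.prob (y.2 + β) y.1.1 * B.prob β y.1.2) * φ y =
      ∑ y : (A.Out × B.Out) × ZMod 2,
        2 * ((1 / 2) * (A.prob (y.2 + β) y.1.1 * B.prob β y.1.2)) * φ y
    refine Finset.sum_congr rfl fun y _ => ?_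
    ring
  · change ∑ y : (A.Out × B.Out) × ZMod 2, (A.prob y.2 y.1.1 * B.prob β y.1.2) * φ y.1.2 =
      ∑ y : B.Out, 2 * B.prob β y * φ y
    rw [Fintype.sum_prod_type, Fintype.sum_prod_type, Finset.sum_comm]
    refine Finset.sum_congr rfl fun y _ => ?_
    simp only [sum_zmod_two, Finset.sum_add_distrib, ← Finset.sum_mul, A.prob_sum]
    ring

namespace Polarization

theorem encode_add : ∀ {m : ℕ} (P : Polarization m) (x x' : Fin (2 ^ m) → ZMod 2),
    P.encode (x + x') = P.encode x + P.encode x'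
  | _, nil, _, _ => rfl
  | _, level π T up lo, x, x' => by
    have h1 := encode_add up (fun i => x (fstHalf i)) (fun i => x' (fstHalf i))
    have h2 := encode_add lo (fun i => x (sndHalf i)) (fun i => x' (sndHalf i))
    funext q
    obtain ⟨q, rfl⟩ := π.surjective q
    obtain ⟨i | i, rfl⟩ := (pairs_bijective _).2 q
    · have e1 := congrFun h1 i
      have e2 := congrFun h2 i
      simp only [Pi.add_apply, Pi.add_def] at e1 e2
      simp only [encode, Sum.elim_inl, Pi.add_apply, Equiv.symm_apply_apply, joinPairs_fstOfPair,
        e1, e2]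
      split_ifs
      · rfl
      · ring
    · have e2 := congrFun h2 i
      simp only [Pi.add_apply, Pi.add_def] at e2
      simp only [encode, Sum.elim_inr, Pi.add_apply, Equiv.symm_apply_apply, joinPairs_sndOfPair,
        e2]

theorem encode_fst {m : ℕ} (π : Equiv.Perm (Fin (2 ^ (m + 1)))) (T : Fin (2 ^ m) → Bool)
    (up lo : Polarization m) (x : Fin (2 ^ (m + 1)) → ZMod 2) (i : Fin (2 ^ m)) :
    (level π T up lo).encode x (π (fstOfPair i)) =
      if T i then up.encode (fun i => x (fstHalf i)) i
      else up.encode (fun i => x (fstHalf i)) i + lo.encode (fun i => x (sndHalf i)) i := by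
  simp only [encode, Equiv.symm_apply_apply, joinPairs_fstOfPair]

theorem encode_snd {m : ℕ} (π : Equiv.Perm (Fin (2 ^ (m + 1)))) (T : Fin (2 ^ m) → Bool)
    (up lo : Polarization m) (x : Fin (2 ^ (m + 1)) → ZMod 2) (i : Fin (2 ^ m)) :
    (level π T up lo).encode x (π (sndOfPair i)) = lo.encode (fun i => x (sndHalf i)) i := by
  simp only [encode, Equiv.symm_apply_apply, joinPairs_sndOfPair]

theorem encode_injective : ∀ {m : ℕ} (P : Polarization m), Function.Injective P.encode
  | _, nil => Function.injective_id
  | _, level π T up lo => by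
    intro x x' h
    have hl : (fun i => x (sndHalf i)) = fun i => x' (sndHalf i) := by
      apply encode_injective lo
      funext i
      have := congrFun h (π (sndOfPair i))
      rwa [encode_snd, encode_snd] at this
    have hu : (fun i => x (fstHalf i)) = fun i => x' (fstHalf i) := by
      apply encode_injective up
      funext i
      have := congrFun h (π (fstOfPair i))
      rw [encode_fst, encode_fst, hl] at this
      split_ifs at this
      · exact this
      · exact add_right_cancel this
    funext p
    obtain ⟨q | q, rfl⟩ := (halves_bijective _).2 p
    · exact congrFun hu q
    · exact congrFun hl q

theorem sum_encode {m : ℕ} (P : Polarization m) (H : (Fin (2 ^ m) → ZMod 2) → ℝ) :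
    ∑ x, H (P.encode x) = ∑ x, H x :=
  Fintype.sum_bijective P.encode (Finite.injective_iff_bijective.1 P.encode_injective) _ _
    fun _ => rfl

/-- Probability of the outputs `y` when `x` is encoded and sent. -/
def transProb {m : ℕ} (P : Polarization m) (W : Fin (2 ^ m) → Channel.{u})
    (x : Fin (2 ^ m) → ZMod 2) (y : ∀ j, (W j).Out) : ℝ :=
  ∏ j, (W j).prob (P.encode x j) (y j)

theorem transProb_nonneg {m : ℕ} (P : Polarization m) (W : Fin (2 ^ m) → Channel.{u})
    (x : Fin (2 ^ m) → ZMod 2) (y : ∀ j, (W j).Out) : 0 ≤ P.transProb W x y :=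
  Finset.prod_nonneg fun j _ => (W j).prob_nonneg _ _

theorem transProb_level {m : ℕ} (π : Equiv.Perm (Fin (2 ^ (m + 1)))) (T : Fin (2 ^ m) → Bool)
    (up lo : Polarization m) (W : Fin (2 ^ (m + 1)) → Channel.{u})
    (x : Fin (2 ^ (m + 1)) → ZMod 2) (y : ∀ j, (W j).Out) :
    (level π T up lo).transProb W x y = ∏ i,
      ((W (π (fstOfPair i))).prob
        (if T i then up.encode (fun i => x (fstHalf i)) i
          else up.encode (fun i => x (fstHalf i)) i + lo.encode (fun i => x (sndHalf i)) i)
          (y (π (fstOfPair i))) *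
        (W (π (sndOfPair i))).prob (lo.encode (fun i => x (sndHalf i)) i)
          (y (π (sndOfPair i)))) := by
  unfold transProb
  rw [← Equiv.prod_comp π, prod_pairs]
  simp only [encode_fst, encode_snd]

/-- As the encoding of the lower half is a bijection, summing over its inputs is summing over
arbitrary words. The sum then factorizes over the pairs, and each pair yields twice the transition
probability of the upper channel. -/
theorem sum_transProb_upper {m : ℕ} (π : Equiv.Perm (Fin (2 ^ (m + 1)))) (T : Fin (2 ^ m) → Bool)
    (up lo : Polarization m) (W : Fin (2 ^ (m + 1)) → Channel.{u})
    (G : (Fin (2 ^ m) → ZMod 2) → (∀ i, (if T i then W (π (fstOfPair i))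
      else (W (π (fstOfPair i))).minus (W (π (sndOfPair i)))).Out) → ℝ) :
    ∑ y, ∑ x, (level π T up lo).transProb W x y * G (fun i => x (fstHalf i))
      (fun i => upperOut (T i) _ _ (y (π (fstOfPair i)), y (π (sndOfPair i)))) =
    2 ^ 2 ^ m * ∑ y, ∑ x, up.transProb (fun i => if T i then W (π (fstOfPair i))
      else (W (π (fstOfPair i))).minus (W (π (sndOfPair i)))) x y * G x y := by
  simp only [transProb_level]
  rw [sum_split_outputs π W fun y => ∑ x : Fin (2 ^ (m + 1)) → ZMod 2,
    (∏ i, ((W (π (fstOfPair i))).prob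
        (if T i then up.encode (fun i => x (fstHalf i)) i
          else up.encode (fun i => x (fstHalf i)) i + lo.encode (fun i => x (sndHalf i)) i)
          (y i).1 *
        (W (π (sndOfPair i))).prob (lo.encode (fun i => x (sndHalf i)) i) (y i).2)) *
      G (fun i => x (fstHalf i)) (fun i => upperOut (T i) _ _ (y i))]
  have step : ∀ y : ∀ i, (W (π (fstOfPair i))).Out × (W (π (sndOfPair i))).Out,
      ∑ x : Fin (2 ^ (m + 1)) → ZMod 2, (∏ i, ((W (π (fstOfPair i))).prob
        (if T i then up.encode (fun i => x (fstHalf i)) i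
          else up.encode (fun i => x (fstHalf i)) i + lo.encode (fun i => x (sndHalf i)) i)
          (y i).1 *
        (W (π (sndOfPair i))).prob (lo.encode (fun i => x (sndHalf i)) i) (y i).2)) *
      G (fun i => x (fstHalf i)) (fun i => upperOut (T i) _ _ (y i)) =
      ∑ x : Fin (2 ^ m) → ZMod 2, (∏ i, ∑ β, ((W (π (fstOfPair i))).prob
        (if T i then up.encode x i else up.encode x i + β) (y i).1 *
          (W (π (sndOfPair i))).prob β (y i).2)) *
        G x (fun i => upperOut (T i) _ _ (y i)) := by
    intro y
    rw [sum_split_word fun x x' => (∏ i, ((W (π (fstOfPair i))).prob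
        (if T i then up.encode x i else up.encode x i + lo.encode x' i) (y i).1 *
          (W (π (sndOfPair i))).prob (lo.encode x' i) (y i).2)) *
        G x (fun i => upperOut (T i) _ _ (y i))]
    refine Finset.sum_congr rfl fun x _ => ?_
    rw [← Finset.sum_mul, sum_encode lo fun x' => ∏ i, ((W (π (fstOfPair i))).prob
        (if T i then up.encode x i else up.encode x i + x' i) (y i).1 *
          (W (π (sndOfPair i))).prob (x' i) (y i).2), Finset.prod_univ_sum, Fintype.piFinset_univ]
  simp only [step]
  conv_lhs => rw [Finset.sum_comm]
  conv_rhs => rw [Finset.sum_comm]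
  rw [Finset.mul_sum]
  refine Finset.sum_congr rfl fun x _ => ?_
  rw [sum_prod_map (fun i => upperOut (T i) (W (π (fstOfPair i))) (W (π (sndOfPair i)))) _ _
    (fun i φ => sum_upperOut (T i) _ _ (up.encode x i) φ) (G x), Finset.mul_sum]
  refine Finset.sum_congr rfl fun y _ => ?_
  rw [Finset.prod_mul_distrib, Finset.prod_const, Finset.card_univ, Fintype.card_fin, mul_assoc]
  rfl

/-- Here the encoded word of the upper half, again arbitrary, is moved to the output side, one bit
to each pair, so that the pairs are independent given the lower inputs. -/
theorem sum_transProb_lower {m : ℕ} (π : Equiv.Perm (Fin (2 ^ (m + 1)))) (T : Fin (2 ^ m) → Bool)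
    (up lo : Polarization m) (W : Fin (2 ^ (m + 1)) → Channel.{u})
    (G : (Fin (2 ^ m) → ZMod 2) → (∀ i, (if T i then W (π (sndOfPair i))
      else (W (π (fstOfPair i))).plus (W (π (sndOfPair i)))).Out) → ℝ) :
    ∑ y, ∑ x, (level π T up lo).transProb W x y * G (fun i => x (sndHalf i))
      (fun i => lowerOut (T i) _ _ ((y (π (fstOfPair i)), y (π (sndOfPair i))),
        up.encode (fun i => x (fstHalf i)) i)) =
    2 ^ 2 ^ m * ∑ y, ∑ x, lo.transProb (fun i => if T i then W (π (sndOfPair i))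
      else (W (π (fstOfPair i))).plus (W (π (sndOfPair i)))) x y * G x y := by
  simp only [transProb_level]
  rw [sum_split_outputs π W fun y => ∑ x : Fin (2 ^ (m + 1)) → ZMod 2,
    (∏ i, ((W (π (fstOfPair i))).prob
        (if T i then up.encode (fun i => x (fstHalf i)) i
          else up.encode (fun i => x (fstHalf i)) i + lo.encode (fun i => x (sndHalf i)) i)
          (y i).1 *
        (W (π (sndOfPair i))).prob (lo.encode (fun i => x (sndHalf i)) i) (y i).2)) *
      G (fun i => x (sndHalf i))
        (fun i => lowerOut (T i) _ _ (y i, up.encode (fun i => x (fstHalf i)) i))]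
  have step : ∀ y : ∀ i, (W (π (fstOfPair i))).Out × (W (π (sndOfPair i))).Out,
      ∑ x : Fin (2 ^ (m + 1)) → ZMod 2, (∏ i, ((W (π (fstOfPair i))).prob
        (if T i then up.encode (fun i => x (fstHalf i)) i
          else up.encode (fun i => x (fstHalf i)) i + lo.encode (fun i => x (sndHalf i)) i)
          (y i).1 *
        (W (π (sndOfPair i))).prob (lo.encode (fun i => x (sndHalf i)) i) (y i).2)) *
      G (fun i => x (sndHalf i))
        (fun i => lowerOut (T i) _ _ (y i, up.encode (fun i => x (fstHalf i)) i)) =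
      ∑ x' : Fin (2 ^ m) → ZMod 2, ∑ a : Fin (2 ^ m) → ZMod 2, (∏ i, ((W (π (fstOfPair i))).prob
        (if T i then a i else a i + lo.encode x' i) (y i).1 *
          (W (π (sndOfPair i))).prob (lo.encode x' i) (y i).2)) *
        G x' (fun i => lowerOut (T i) _ _ (y i, a i)) := by
    intro y
    rw [sum_split_word fun x x' => (∏ i, ((W (π (fstOfPair i))).prob
        (if T i then up.encode x i else up.encode x i + lo.encode x' i) (y i).1 *
          (W (π (sndOfPair i))).prob (lo.encode x' i) (y i).2)) *
        G x' (fun i => lowerOut (T i) _ _ (y i, up.encode x i)), Finset.sum_comm]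
    refine Finset.sum_congr rfl fun x' _ => ?_
    rw [sum_encode up fun a => (∏ i, ((W (π (fstOfPair i))).prob
        (if T i then a i else a i + lo.encode x' i) (y i).1 *
          (W (π (sndOfPair i))).prob (lo.encode x' i) (y i).2)) *
        G x' (fun i => lowerOut (T i) _ _ (y i, a i))]
  simp only [step]
  conv_lhs => rw [Finset.sum_comm]
  conv_rhs => rw [Finset.sum_comm]
  rw [Finset.mul_sum]
  refine Finset.sum_congr rfl fun x' _ => ?_
  rw [← Fintype.sum_prod_type', ← Equiv.sum_comp (Equiv.arrowProdEquivProdArrow (Fin (2 ^ m))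
    (fun i => (W (π (fstOfPair i))).Out × (W (π (sndOfPair i))).Out) (fun _ => ZMod 2))]
  refine (sum_prod_map (fun i => lowerOut (T i) (W (π (fstOfPair i))) (W (π (sndOfPair i)))) _ _
    (fun i φ => sum_lowerOut (T i) _ _ (lo.encode x' i) φ) (G x')).trans ?_
  rw [Finset.mul_sum]
  refine Finset.sum_congr rfl fun y _ => ?_
  rw [Finset.prod_mul_distrib, Finset.prod_const, Finset.card_univ, Fintype.card_fin, mul_assoc]
  rfl

theorem two_pow_two_pow_mul_self (m : ℕ) : (2 : ℝ) ^ 2 ^ m * 2 ^ 2 ^ m = 2 ^ 2 ^ (m + 1) := by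
  rw [← pow_add, ← mul_two, ← pow_succ]

/-- `V` is the channel from the `i`-th input of the polarization `P` of `W` to a statistic of the
outputs and of the preceding inputs, the other inputs being uniform. -/
def IsBitChannel {m : ℕ} (P : Polarization m) (W : Fin (2 ^ m) → Channel.{u}) (i : Fin (2 ^ m))
    (V : Channel.{u}) : Prop :=
  ∃ F : (∀ j, (W j).Out) → (Fin (2 ^ m) → ZMod 2) → V.Out,
    (∀ y x x', (∀ j < i, x j = x' j) → F y x = F y x') ∧
    ∀ φ : ZMod 2 → V.Out → ℝ, 2 * ∑ y, ∑ x, P.transProb W x y * φ (x i) (F y x) =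
      2 ^ 2 ^ m * ∑ β, ∑ o, V.prob β o * φ β o

/-- Induction on the levels, composing the statistic of a half with `upperOut` or `lowerOut`.
Realizing the channel by a statistic avoids identifying its output alphabet with received sequences
and bits, and only this direction is needed for error bounds. -/
theorem isBitChannel_channels : ∀ {m : ℕ} (P : Polarization m) (W : Fin (2 ^ m) → Channel.{u})
    (i : Fin (2 ^ m)), P.IsBitChannel W i (P.channels W i)
  | _, nil, W, i => by
    let _ : Unique (Fin (2 ^ 0)) := inferInstanceAs (Unique (Fin 1))
    obtain rfl : i = default := Subsingleton.elim _ _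
    refine ⟨fun y _ => y default, fun _ _ _ _ => rfl, fun φ => ?_⟩
    simp only [transProb, Fintype.prod_unique, pow_zero, pow_one]
    rw [Finset.sum_comm]
    congr 1
    rw [← Equiv.sum_comp (Equiv.funUnique (Fin (2 ^ 0)) (ZMod 2))]
    refine Finset.sum_congr rfl fun x _ => ?_
    exact Fintype.sum_equiv (Equiv.piUnique fun j : Fin (2 ^ 0) => (W j).Out) _ _ fun _ => rfl
  | m + 1, level π T up lo, W, p => by
    obtain ⟨i | i, rfl⟩ := (halves_bijective _).2 p
    · obtain ⟨F, hF, hlaw⟩ := isBitChannel_channels up (fun i => if T i then W (π (fstOfPair i))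
        else (W (π (fstOfPair i))).minus (W (π (sndOfPair i)))) i
      have e : (level π T up lo).channels W (fstHalf i) =
        up.channels (fun i => if T i then W (π (fstOfPair i))
          else (W (π (fstOfPair i))).minus (W (π (sndOfPair i)))) i := joinHalves_fstHalf _ _ i
      rw [Sum.elim_inl, e]
      refine ⟨fun y x => F (fun i => upperOut (T i) _ _ (y (π (fstOfPair i)), y (π (sndOfPair i))))
        fun i => x (fstHalf i), fun y x x' h => hF _ _ _ fun j hj => h _ ?_, fun φ => ?_⟩
      · exact hj
      · rw [sum_transProb_upper π T up lo W fun x y => φ (x i) (F y x), mul_left_comm, hlaw,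
          ← mul_assoc, two_pow_two_pow_mul_self]
    · obtain ⟨F, hF, hlaw⟩ := isBitChannel_channels lo (fun i => if T i then W (π (sndOfPair i))
        else (W (π (fstOfPair i))).plus (W (π (sndOfPair i)))) i
      have e : (level π T up lo).channels W (sndHalf i) =
        lo.channels (fun i => if T i then W (π (sndOfPair i))
          else (W (π (fstOfPair i))).plus (W (π (sndOfPair i)))) i := joinHalves_sndHalf _ _ i
      rw [Sum.elim_inr, e]
      refine ⟨fun y x => F (fun i => lowerOut (T i) _ _ ((y (π (fstOfPair i)),
        y (π (sndOfPair i))), up.encode (fun i => x (fstHalf i)) i))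
        fun i => x (sndHalf i), fun y x x' h => ?_, fun φ => ?_⟩
      -- The statistic of the lower half may use the whole upper word, since all of it precedes.
      · have h1 : (fun i => x (fstHalf i)) = fun i => x' (fstHalf i) := by
          funext j
          refine h _ ?_
          simp only [fstHalf, sndHalf, Fin.mk_lt_mk]
          omega
        simp only [h1]
        refine hF _ _ _ fun j hj => h _ ?_
        simpa [sndHalf] using hj
      · rw [sum_transProb_lower π T up lo W fun x y => φ (x i) (F y x), mul_left_comm, hlaw,
          ← mul_assoc, two_pow_two_pow_mul_self]

end Polarization

/-! ### Maximum-likelihood decisions -/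

theorem ite_congr_of_iff {α : Type*} {p q : Prop} {dp : Decidable p} {dq : Decidable q}
    {a a' b : α} (h : p ↔ q) (ha : a = a') : (if p then a else b) = if q then a' else b := by
  subst ha
  by_cases hp : p
  · rw [if_pos hp, if_pos (h.1 hp)]
  · rw [if_neg hp, if_neg fun hq => hp (h.2 hq)]

/-- A binary hypothesis `β` is decided by maximum likelihood from an observation `key`. The
probability of a wrong decision or tie is bounded by the Bhattacharyya parameter of any statistic
`F` of the observation. -/
theorem sum_ml_error_le {Ω K O : Type*} [Fintype Ω] [Fintype K] [Fintype O]
    [DecidableEq K] [DecidableEq O] (p : Ω → ℝ)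
    (hp : ∀ ω, 0 ≤ p ω) (key : Ω → K) (β : Ω → ZMod 2) (F : K → O) :
    ∑ ω, (if (∑ ω', if key ω' = key ω ∧ β ω' = β ω then p ω' else 0) ≤
        ∑ ω', (if key ω' = key ω ∧ β ω' = β ω + 1 then p ω' else 0) then p ω else 0) ≤
      2 * ∑ o, Real.sqrt ((∑ ω, p ω * if β ω = 0 ∧ F (key ω) = o then 1 else 0) *
        ∑ ω, p ω * if β ω = 1 ∧ F (key ω) = o then 1 else 0) := by
  set L : K → ZMod 2 → ℝ := fun k b => ∑ ω, if key ω = k ∧ β ω = b then p ω else 0 with hL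
  have hL0 : ∀ k b, 0 ≤ L k b := fun k b => Finset.sum_nonneg fun ω _ => by
    split_ifs
    · exact hp ω
    · exact le_rfl
  have fiber : ∀ g : K → ZMod 2 → ℝ,
      ∑ ω, p ω * g (key ω) (β ω) = ∑ k, ∑ b, L k b * g k b := by
    intro g
    rw [← Fintype.sum_prod_type']
    simp only [hL, Finset.sum_mul]
    rw [Finset.sum_comm]
    refine Finset.sum_congr rfl fun ω _ => ?_
    rw [Finset.sum_eq_single (key ω, β ω)]
    · simp
    · rintro ⟨k, b⟩ - hkb
      rw [if_neg, zero_mul]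
      rintro ⟨rfl, rfl⟩
      exact hkb rfl
    · simp
  have hleft : ∑ ω, (if L (key ω) (β ω) ≤ L (key ω) (β ω + 1) then p ω else 0) =
      ∑ k, ∑ b, L k b * if L k b ≤ L k (b + 1) then 1 else 0 := by
    rw [← fiber fun k b => if L k b ≤ L k (b + 1) then 1 else 0]
    simp
  change ∑ ω, (if L (key ω) (β ω) ≤ L (key ω) (β ω + 1) then p ω else 0) ≤ _
  rw [hleft]
  -- Each hypothesis is charged when it is the less likely one, and at a tie both are; each charge
  -- is at most √(L₀ L₁), whence the factor 2.
  have hstep : ∀ k, ∑ b, L k b * (if L k b ≤ L k (b + 1) then 1 else 0) ≤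
      2 * (Real.sqrt (L k 0) * Real.sqrt (L k 1)) := by
    intro k
    have aux : ∀ x y : ℝ, 0 ≤ x → 0 ≤ y →
        x * (if x ≤ y then 1 else 0) ≤ Real.sqrt x * Real.sqrt y := by
      intro x y hx hy
      split_ifs with h
      · rw [mul_one]
        nth_rewrite 1 [← Real.mul_self_sqrt hx]
        exact mul_le_mul_of_nonneg_left (Real.sqrt_le_sqrt h) (Real.sqrt_nonneg _)
      · rw [mul_zero]; positivity
    have h3 : (1 : ZMod 2) + 1 = 0 := by decide
    rw [sum_zmod_two, zero_add, h3]
    linarith [aux _ _ (hL0 k 0) (hL0 k 1), aux _ _ (hL0 k 1) (hL0 k 0),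
      mul_comm (Real.sqrt (L k 0)) (Real.sqrt (L k 1))]
  refine (Finset.sum_le_sum fun k _ => hstep k).trans ?_
  rw [← Finset.mul_sum, ← Finset.sum_fiberwise Finset.univ F]
  refine mul_le_mul_of_nonneg_left (Finset.sum_le_sum fun o _ => ?_) two_pos.le
  have hV : ∀ b : ZMod 2, ∑ ω, (p ω * if β ω = b ∧ F (key ω) = o then 1 else 0) =
      ∑ k with F k = o, L k b := by
    intro b
    rw [fiber fun k b' => if b' = b ∧ F k = o then 1 else 0, Finset.sum_filter]
    refine Finset.sum_congr rfl fun k _ => ?_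
    by_cases h : F k = o <;> simp [h]
  -- Cauchy–Schwarz on the fibres of `F`: passing to a statistic can only increase the Bhattacharyya
  -- parameter.
  rw [hV, hV, Real.sqrt_mul (Finset.sum_nonneg fun k _ => hL0 k 0)]
  exact Real.sum_sqrt_mul_sqrt_le _ (fun k => hL0 k 0) (fun k => hL0 k 1)

namespace Polarization

variable {m : ℕ} (P : Polarization m) (W : Fin (2 ^ m) → Channel.{u})

/-- Likelihood, up to a constant factor, of the value `β` of the `i`-th input, given the outputs
`y` and the preceding inputs (read off from `x`). -/
def lik (y : ∀ j, (W j).Out) (x : Fin (2 ^ m) → ZMod 2) (i : Fin (2 ^ m)) (β : ZMod 2) : ℝ :=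
  ∑ w, if (∀ j < i, w j = x j) ∧ w i = β then P.transProb W w y else 0

/-- Probability that, when `x` is encoded and sent, the `i`-th input is not strictly more likely
than the other value of this bit given the outputs and the preceding inputs. -/
def mlError (x : Fin (2 ^ m) → ZMod 2) (i : Fin (2 ^ m)) : ℝ :=
  ∑ y, if P.lik W y x i (x i) ≤ P.lik W y x i (x i + 1) then P.transProb W x y else 0

theorem sum_mlError_le (i : Fin (2 ^ m)) :
    ∑ x, P.mlError W x i ≤ 2 ^ 2 ^ m * (P.channels W i).bhatt := by
  classical
  obtain ⟨F, hF, hlaw⟩ := P.isBitChannel_channels W i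
  -- Overwriting all later inputs by 0 turns the preceding inputs into an observation of fixed type.
  set tr : (Fin (2 ^ m) → ZMod 2) → Fin (2 ^ m) → ZMod 2 := fun x j => if j < i then x j else 0
    with htr
  have htr_iff : ∀ w x, tr w = tr x ↔ ∀ j < i, w j = x j := by
    intro w x
    constructor
    · intro h j hj
      simpa [htr, hj] using congrFun h j
    · intro h
      funext j
      simp only [htr]
      split_ifs with hj
      · exact h j hj
      · rfl
  have hFtr : ∀ y x, F y (tr x) = F y x := fun y x => hF _ _ _ fun j hj => by simp [htr, hj]
  have h := sum_ml_error_le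
    (fun ω : (∀ j, (W j).Out) × (Fin (2 ^ m) → ZMod 2) => P.transProb W ω.2 ω.1)
    (fun ω => P.transProb_nonneg W _ _) (fun ω => (ω.1, tr ω.2)) (fun ω => ω.2 i)
    (fun k => F k.1 k.2)
  have hlik : ∀ (y : ∀ j, (W j).Out) (x : Fin (2 ^ m) → ZMod 2) (β : ZMod 2),
      (∑ ω : (∀ j, (W j).Out) × (Fin (2 ^ m) → ZMod 2),
        if (ω.1, tr ω.2) = (y, tr x) ∧ ω.2 i = β then P.transProb W ω.2 ω.1 else 0) =
      P.lik W y x i β := by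
    intro y x β
    rw [Fintype.sum_prod_type, Finset.sum_eq_single y]
    · unfold lik
      refine Finset.sum_congr rfl fun w _ => ite_congr_of_iff ?_ rfl
      rw [Prod.mk.injEq, htr_iff]
      simp
    · intro y' _ hy
      simp [hy]
    · simp
  simp only [hlik, hFtr] at h
  have hV : ∀ (b : ZMod 2) (o : (P.channels W i).Out),
      ∑ ω : (∀ j, (W j).Out) × (Fin (2 ^ m) → ZMod 2),
        (P.transProb W ω.2 ω.1 * if ω.2 i = b ∧ F ω.1 ω.2 = o then 1 else 0) =
      2 ^ 2 ^ m / 2 * (P.channels W i).prob b o := by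
    intro b o
    rw [Fintype.sum_prod_type]
    have := hlaw fun β o' => if β = b ∧ o' = o then 1 else 0
    have e : ∑ β, ∑ o', (P.channels W i).prob β o' * (if β = b ∧ o' = o then 1 else 0) = (P.channels W i).prob b o := by
      rw [Finset.sum_eq_single b, Finset.sum_eq_single o] <;> simp +contextual
    rw [e] at this
    linarith
  simp only [hV] at h
  have hsq : ∀ o, Real.sqrt (2 ^ 2 ^ m / 2 * (P.channels W i).prob 0 o * (2 ^ 2 ^ m / 2 * (P.channels W i).prob 1 o)) =
      2 ^ 2 ^ m / 2 * Real.sqrt ((P.channels W i).prob 0 o * (P.channels W i).prob 1 o) := by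
    intro o
    rw [mul_mul_mul_comm, Real.sqrt_mul (by positivity), Real.sqrt_mul_self (by positivity)]
  simp only [hsq, ← Finset.mul_sum] at h
  rw [Fintype.sum_prod_type, Finset.sum_comm] at h
  refine h.trans_eq ?_
  unfold Channel.bhatt
  ring

variable {W}

/-- The encoding is linear, so adding `v` flips the transmitted bits exactly where `encode v` is 1;
the channel involutions at these positions undo the flips. -/
theorem exists_symmetry (hW : ∀ j, (W j).IsBMS) (v : Fin (2 ^ m) → ZMod 2) :
    ∃ s : Equiv.Perm (∀ j, (W j).Out), ∀ x y,
      P.transProb W (x + v) (s y) = P.transProb W x y := by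
  choose σ hσ hσW using hW
  refine ⟨Equiv.piCongrRight fun j => if P.encode v j = 0 then 1 else σ j, fun x y => ?_⟩
  unfold transProb
  refine Finset.prod_congr rfl fun j _ => ?_
  rw [encode_add, Pi.add_apply, Equiv.piCongrRight_apply, Pi.map_apply]
  have h01 : ∀ t : ZMod 2, t = 0 ∨ t = 1 := by decide
  have h3 : (1 : ZMod 2) + 1 = 0 := by decide
  rcases h01 (P.encode v j) with h | h
  · simp [h]
  · rw [h, if_neg (by decide)]
    rcases h01 (P.encode x j) with h' | h'
    · rw [h', zero_add, hσW, hσ]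
    · rw [h', h3, hσW]

theorem mlError_add (hW : ∀ j, (W j).IsBMS) (x v : Fin (2 ^ m) → ZMod 2) (i : Fin (2 ^ m)) :
    P.mlError W (x + v) i = P.mlError W x i := by
  classical
  obtain ⟨s, hs⟩ := P.exists_symmetry hW v
  have hl : ∀ y β, P.lik W (s y) (x + v) i (β + v i) = P.lik W y x i β := by
    intro y β
    unfold lik
    rw [← Equiv.sum_comp (Equiv.addRight v)]
    refine Finset.sum_congr rfl fun w _ => ?_
    simp only [Equiv.coe_addRight, Pi.add_apply, add_left_inj, hs]
  unfold mlError
  rw [← Equiv.sum_comp s]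
  refine Finset.sum_congr rfl fun y _ => ?_
  rw [hs, Pi.add_apply, add_right_comm, hl, hl]

/-- All words have the same error by symmetry, so the average bound holds for each of them, in
particular for words whose frozen bits are 0. -/
theorem mlError_le (hW : ∀ j, (W j).IsBMS) (x : Fin (2 ^ m) → ZMod 2) (i : Fin (2 ^ m)) :
    P.mlError W x i ≤ (P.channels W i).bhatt := by
  have h := P.sum_mlError_le W i
  have e : ∀ x', P.mlError W x' i = P.mlError W x i := fun x' => by
    rw [← P.mlError_add hW x (x' - x) i, add_sub_cancel]
  simp only [e, Finset.sum_const, Finset.card_univ, Fintype.card_fun, ZMod.card, Fintype.card_fin,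
    nsmul_eq_mul] at h
  push_cast at h
  exact le_of_mul_le_mul_left h (by positivity)

end Polarization

/-! ### Codes with a single set in the partition -/

/-- The two-stage code with `N₁ = 2^n` and `N₂ = 1`, in which all bit-channels of the first stage
are selected. -/
def singleSetCode {n : ℕ} (P : Polarization n) (info : Finset (Fin (2 ^ n) × Fin (2 ^ 0))) :
    TwoStageCode n where
  n₁ := n
  n₂ := 0
  add_eq := rfl
  part := Equiv.uniqueProd (Fin (2 ^ n)) (Fin 1)
  first _ := P
  M := 2 ^ n
  sel _ := RelEmbedding.refl _
  second _ := .nil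
  info := info

namespace TwoStageCode

theorem foldl_induction {α : Type*} {N : ℕ} (step : α → Fin N → α) (init : α)
    (motive : ℕ → α → Prop) (h0 : motive 0 init)
    (hs : ∀ (i : Fin N) s, motive i.1 s → motive (i.1 + 1) (step s i)) :
    motive N (Fin.foldl N step init) := by
  induction N with
  | zero => simpa using h0
  | succ N ih =>
    rw [Fin.foldl_succ_last]
    exact hs (Fin.last N) _ (ih (fun s i => step s i.castSucc) fun i s h => hs i.castSucc s h)

variable {n : ℕ} (P : Polarization n) (info : Finset (Fin (2 ^ n) × Fin (2 ^ 0)))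

theorem singleSetCode_codeword (w : (singleSetCode P info).Word) (j : Fin (2 ^ n)) :
    (singleSetCode P info).codeword w j = P.encode (w (0 : Fin 1)) j := by
  have h : (singleSetCode P info).stageTwo w (0 : Fin 1) = w (0 : Fin 1) := by
    funext i
    have hi : ∃ r, (singleSetCode P info).sel (0 : Fin 1) r = i := ⟨i, rfl⟩
    unfold stageTwo
    rw [dif_pos hi]
    exact congrArg (w (0 : Fin 1)) hi.choose_spec
  exact congrFun (congrArg P.encode h) j

theorem singleSetCode_transition (W : Fin (2 ^ n) → Channel.{u}) (y : ∀ j, (W j).Out)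
    (w : (singleSetCode P info).Word) :
    (singleSetCode P info).transition W y w = P.transProb W (w (0 : Fin 1)) y := by
  unfold transition Polarization.transProb
  simp only [singleSetCode_codeword]

theorem singleSetCode_precedes (i' : Fin (2 ^ n)) (r : Fin (2 ^ n)) :
    (singleSetCode P info).Precedes (0 : Fin 1) i' r (0 : Fin 1) ↔ i' < r := by
  change i' < r ∨ (i' = r ∧ (0 : Fin 1) < 0) ↔ i' < r
  simp

theorem singleSetCode_likelihood (W : Fin (2 ^ n) → Channel.{u}) (y : ∀ j, (W j).Out)
    (s : (singleSetCode P info).Word) (r : Fin (2 ^ n)) (β : ZMod 2) :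
    (singleSetCode P info).likelihood W y s r (0 : Fin 1) β =
      (1 / 2) ^ (2 ^ n - 1) * P.lik W y (s (0 : Fin 1)) r β := by
  classical
  unfold likelihood Polarization.lik
  congr 1
  refine Fintype.sum_equiv (Equiv.funUnique (Fin 1) (Fin (2 ^ n) → ZMod 2)) _ _ fun w => ?_
  refine ite_congr_of_iff (and_congr ?_ Iff.rfl) (singleSetCode_transition P info W y w)
  constructor
  · intro h j hj
    exact h (0 : Fin 1) j ((singleSetCode_precedes P info j r).2 hj)
  · intro h k j hj
    obtain rfl : k = (0 : Fin 1) := Subsingleton.elim (α := Fin 1) _ _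
    exact h j ((singleSetCode_precedes P info j r).1 hj)

open Classical in
theorem singleSetCode_word (msg : info → ZMod 2) :
    (∀ r, (r, (0 : Fin 1)) ∉ info →
      (singleSetCode P info).word msg (0 : Fin 1) r = 0) ∧
    ∀ p : info, (singleSetCode P info).word msg p.1.2 p.1.1 = msg p := by
  constructor
  · intro r hr
    unfold word
    rw [dif_neg]
    rintro ⟨⟨⟨r', k⟩, hp⟩, hk, rfl⟩
    obtain rfl : k = (0 : Fin 1) := hk
    exact hr hp
  · intro p
    have h : ∃ q : (singleSetCode P info).info, q.1.2 = p.1.2 ∧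
        (singleSetCode P info).sel q.1.2 q.1.1 = p.1.1 := ⟨p, rfl, rfl⟩
    unfold word
    rw [dif_pos h]
    exact congrArg msg (Subtype.ext (Prod.ext h.choose_spec.2 h.choose_spec.1))

/-- If each information bit is strictly more likely than its complement, given the correct
preceding bits, then successive cancellation makes no error. -/
theorem singleSetCode_scDecode (W : Fin (2 ^ n) → Channel.{u}) (y : ∀ j, (W j).Out)
    (w : Fin (2 ^ n) → ZMod 2) (hw : ∀ r, (r, (0 : Fin 1)) ∉ info → w r = 0)
    (h : ∀ r, (r, (0 : Fin 1)) ∈ info → P.lik W y w r (w r + 1) < P.lik W y w r (w r)) :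
    (singleSetCode P info).scDecode W y (0 : Fin 1) = w := by
  classical
  have key := foldl_induction
    (fun (s : (singleSetCode P info).Word) (r : Fin (2 ^ n)) =>
      Fin.foldl (2 ^ 0) (fun s k => (singleSetCode P info).scStep W y s r k) s)
    (fun _ _ => 0)
    -- Agreement on the bits already decided suffices, as the likelihoods depend on `s` only through
    -- them.
    (fun j s => ∀ i : Fin (2 ^ n), i.1 < j → s (0 : Fin 1) i = w i)
    (fun i hi => absurd hi (Nat.not_lt_zero _)) ?_
  · funext i
    exact key i i.2
  · intro r s hs i hi
    change (singleSetCode P info).scStep W y s r (0 : Fin 1) (0 : Fin 1) i = w i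
    unfold scStep
    by_cases hir : i = r
    · subst hir
      have hlik : ∀ β, P.lik W y (s (0 : Fin 1)) i β = P.lik W y w i β := by
        intro β
        unfold Polarization.lik
        refine Finset.sum_congr rfl fun x _ => ite_congr_of_iff (and_congr_left' ?_) rfl
        exact forall₂_congr fun j hj => by rw [hs j hj]
      rw [if_pos ⟨rfl, rfl⟩]
      have hc : (0 : ℝ) < (1 / 2) ^ (2 ^ n - 1) := by positivity
      have hcond : (singleSetCode P info).likelihood W y s i (0 : Fin 1) 0 <
          (singleSetCode P info).likelihood W y s i (0 : Fin 1) 1 ↔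
          P.lik W y w i 0 < P.lik W y w i 1 := by
        rw [singleSetCode_likelihood, singleSetCode_likelihood, hlik, hlik,
          mul_lt_mul_iff_right₀ hc]
      have h01 : ∀ t : ZMod 2, t = 0 ∨ t = 1 := by decide
      have h3 : (1 : ZMod 2) + 1 = 0 := by decide
      -- The decoder resolves ties to 0; strictness in the hypothesis excludes ties, so both values
      -- of the bit are decided correctly.
      by_cases hin : (i, (0 : Fin 1)) ∈ info
      · have hlt := h i hin
        rcases h01 (w i) with h' | h'
        · rw [h', zero_add] at hlt
          rw [h']
          exact if_neg fun hh => lt_asymm (hcond.1 hh.2) hlt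
        · rw [h', h3] at hlt
          rw [h']
          exact if_pos ⟨hin, hcond.2 hlt⟩
      · rw [hw i hin]
        exact if_neg fun hh => hin hh.1
    · rw [if_neg fun hh => hir hh.2]
      refine hs i ?_
      have : i.1 ≠ r.1 := fun hh => hir (Fin.ext hh)
      omega

/-- If decoding fails, some information bit is not strictly more likely than its complement even
given the true preceding bits. The union bound over these events involves no error propagation. -/
theorem singleSetCode_blockError_le (W : Fin (2 ^ n) → Channel.{u}) (hW : ∀ j, (W j).IsBMS) :
    (singleSetCode P info).blockError W ≤ ∑ p : info, (P.channels W p.1.1).bhatt := by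
  classical
  have hmsg : ∀ msg : info → ZMod 2, (∑ y : ∀ j, (W j).Out,
      if ∃ p : info, (singleSetCode P info).scDecode W y p.1.2 p.1.1 ≠ msg p
      then (singleSetCode P info).transition W y ((singleSetCode P info).word msg) else 0) ≤
      ∑ p : info, (P.channels W p.1.1).bhatt := by
    intro msg
    obtain ⟨hw0, hw1⟩ := singleSetCode_word P info msg
    set w := (singleSetCode P info).word msg (0 : Fin 1) with hw
    have hbound : ∀ y : ∀ j, (W j).Out,
        (if ∃ p : info, (singleSetCode P info).scDecode W y p.1.2 p.1.1 ≠ msg p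
        then (singleSetCode P info).transition W y ((singleSetCode P info).word msg) else 0) ≤
        ∑ p : info, if P.lik W y w p.1.1 (w p.1.1) ≤ P.lik W y w p.1.1 (w p.1.1 + 1)
          then P.transProb W w y else 0 := by
      intro y
      have hnn : ∀ p : info, 0 ≤ if P.lik W y w p.1.1 (w p.1.1) ≤
          P.lik W y w p.1.1 (w p.1.1 + 1) then P.transProb W w y else 0 := fun p => by
        split_ifs
        · exact P.transProb_nonneg W w y
        · exact le_rfl
      split_ifs with hex
      · rw [singleSetCode_transition]
        by_contra! hcon
        have hgood : ∀ p : info, P.lik W y w p.1.1 (w p.1.1 + 1) < P.lik W y w p.1.1 (w p.1.1) := by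
          intro p
          by_contra! hp
          have := Finset.single_le_sum (fun q _ => hnn q) (Finset.mem_univ p)
          rw [if_pos hp] at this
          exact absurd hcon (not_lt.2 this)
        have hdec := singleSetCode_scDecode P info W y w hw0 fun r hr => hgood ⟨(r, _), hr⟩
        obtain ⟨p, hp⟩ := hex
        refine hp ?_
        rw [← hw1 p]
        have hk : p.1.2 = (0 : Fin 1) := Subsingleton.elim (α := Fin 1) _ _
        rw [hk]
        exact congrFun hdec p.1.1
      · exact Finset.sum_nonneg fun p _ => hnn p
    refine (Finset.sum_le_sum fun y _ => hbound y).trans ?_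
    rw [Finset.sum_comm]
    exact Finset.sum_le_sum fun p _ => P.mlError_le hW w p.1.1
  unfold blockError
  have hcard : (0 : ℝ) < 2 ^ info.card := by positivity
  refine (div_le_iff₀ hcard).2 ?_
  refine (Finset.sum_le_sum (s := (Finset.univ : Finset (info → ZMod 2)))
    fun msg _ => hmsg msg).trans_eq ?_
  rw [Finset.sum_const, Finset.card_univ, nsmul_eq_mul, mul_comm]
  congr 1
  have : Fintype.card (info → ZMod 2) = 2 ^ info.card := by simp
  exact_mod_cast this

end TwoStageCode

/-! ### The rate -/

theorem exists_threshold {e₁ e₂ δ₁ δ₂ : ℝ} (he₁ : 0 < e₁) (he₂ : 0 < e₂) (hδ₁ : 0 < δ₁)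
    (hδ₂ : 0 < δ₂) : ∃ x : ℝ, 0 < x ∧ x ^ e₁ ≤ δ₁ ∧ x ^ e₂ ≤ δ₂ := by
  have h1 : 0 < δ₁ ^ e₁⁻¹ := Real.rpow_pos_of_pos hδ₁ _
  have h2 : 0 < δ₂ ^ e₂⁻¹ := Real.rpow_pos_of_pos hδ₂ _
  refine ⟨min (δ₁ ^ e₁⁻¹) (δ₂ ^ e₂⁻¹), lt_min h1 h2, ?_, ?_⟩
  · exact (Real.rpow_le_rpow (lt_min h1 h2).le (min_le_left _ _) he₁.le).trans_eq
      (Real.rpow_inv_rpow hδ₁.le he₁.ne')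
  · exact (Real.rpow_le_rpow (lt_min h1 h2).le (min_le_right _ _) he₂.le).trans_eq
      (Real.rpow_inv_rpow hδ₂.le he₂.ne')

/-- With k about n/(μη) the sorted levels contract by 2^(-n/μ), up to rounding; m takes what is left
after reserving n/μ levels without combinations, so that 2^(k+m) ≤ 2^n · 2^(-n/μ). That m is still
about 2n/μ or more is the condition 3 + 1/η ≤ μ. -/
theorem exists_levels {η μ : ℝ} (hη : 0 < η) (hμ : 3 + 1 / η ≤ μ) (n : ℕ) :
    ∃ k m : ℕ, k + m ≤ n ∧ (k + m : ℝ) ≤ n - n / μ ∧ n / μ - η ≤ η * k ∧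
      2 * (n / μ) - 1 ≤ m := by
  have hη' : 0 < 1 / η := by positivity
  have hμ0 : 0 < μ := by linarith
  have hn : (0 : ℝ) ≤ n := Nat.cast_nonneg n
  have hnμ : 0 ≤ n / μ := by positivity
  have hk0 : 0 ≤ n / μ * (1 / η) := by positivity
  have hk1 := Nat.floor_le hk0
  have hk2 := Nat.lt_floor_add_one (n / μ * (1 / η))
  have hsum : n / μ * (3 + 1 / η) ≤ n := by
    rw [div_mul_eq_mul_div, div_le_iff₀ hμ0]
    exact mul_le_mul_of_nonneg_left hμ hn
  set k := ⌊n / μ * (1 / η)⌋₊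
  have hm0 : (0 : ℝ) ≤ n - k - n / μ := by nlinarith
  have hm1 := Nat.floor_le hm0
  have hm2 := Nat.lt_floor_add_one ((n : ℝ) - k - n / μ)
  set m := ⌊(n : ℝ) - k - n / μ⌋₊
  refine ⟨k, m, ?_, by linarith, ?_, by linarith⟩
  · have : ((k + m : ℕ) : ℝ) ≤ n := by push_cast; linarith
    exact_mod_cast this
  · have := mul_le_mul_of_nonneg_left hk2.le hη.le
    have e : η * (n / μ * (1 / η)) = n / μ := by field_simp
    linarith

theorem exists_polarization {b c lam : ℝ} (hb : b ∈ Set.Ioo (0 : ℝ) 1)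
    (hc : c ∈ Set.Ioo (0 : ℝ) (1 / 2)) (hlam : 0 < lam) (heta : 0 < eta b c lam)
    {Pe : ℝ} (hPe : Pe ∈ Set.Ioo (0 : ℝ) 1) {μ : ℝ} (hμ : 3 + 1 / eta b c lam ≤ μ) :
    ∃ C : ℝ, 0 < C ∧ ∀ (n : ℕ) (W : Fin (2 ^ n) → Channel.{u}), ∃ P : Polarization n,
      ∑ i, loss (Pe / 2 ^ n) (P.channels W i) ≤ C * 2 ^ n * 2 ^ (-(n / μ)) := by
  have hη' : 0 < 1 / eta b c lam := by positivity
  have hμ0 : 0 < μ := by linarith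
  -- This makes the threshold cost N^s equal to 2^(n/(4μ)), and keeps s below the exponent 1/4 of ρ
  -- = 2^(1/4).
  set s : ℝ := 1 / (4 * μ) with hs
  set η := eta b c lam
  have hs0 : 0 < s := by positivity
  have hs8 : s ≤ 1 / 8 := one_div_le_one_div_of_le (by norm_num) (by linarith)
  obtain ⟨x₀, hx₀, hxb, hxs⟩ := exists_threshold (δ₁ := 2 - 2 ^ b) (δ₂ := 2 ^ (1 / 4 : ℝ) - 2 ^ s)
    hb.1 hs0
    (sub_pos.2 ((Real.rpow_lt_rpow_of_exponent_lt one_lt_two hb.2).trans_eq (Real.rpow_one 2)))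
    (sub_pos.2 (Real.rpow_lt_rpow_of_exponent_lt one_lt_two (by linarith)))
  set a := (1 / x₀) ^ b
  set g := gapFn b c lam 1 - gapFn b c lam 0
  have ha : 0 < a := Real.rpow_pos_of_pos (by positivity) _
  have hg : 0 ≤ g := sub_nonneg.2 (gapFn_mono hb.1 hlam le_rfl zero_le_one le_rfl)
  have hPs : 0 < (1 / Pe) ^ s := Real.rpow_pos_of_pos (one_div_pos.2 hPe.1) _
  -- The summands account for the contracted potential (2^η from rounding k), for the telescoped
  -- gaps and spreads, and for the threshold term.
  refine ⟨4 * a * 2 ^ η + (3 * a + 4 * a * g) + 2 * (1 / Pe) ^ s, by positivity, fun n W => ?_⟩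
  obtain ⟨k, m, hkm, hkm', hk, hm⟩ := exists_levels heta hμ n
  have h2n : (0 : ℝ) < 2 ^ n := by positivity
  have h1n : (1 : ℝ) ≤ 2 ^ n := one_le_pow₀ one_le_two
  obtain ⟨P, hP⟩ := exists_sum_loss_le (s := s) (x₀ := x₀) (ρ := 2 ^ (1 / 4 : ℝ))
    (θ := Pe / 2 ^ n) hb hc hlam heta hs0 (by linarith) hx₀ (by linarith) (by linarith)
    (div_pos hPe.1 h2n) ((div_le_one h2n).2 (hPe.2.le.trans h1n)) m k n hkm W
  refine ⟨P, hP.trans ?_⟩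
  have e2n : (2 : ℝ) ^ n = 2 ^ (n : ℝ) := (Real.rpow_natCast 2 n).symm
  have t1 : (2 ^ (-η) : ℝ) ^ k ≤ 2 ^ η * 2 ^ (-(n / μ)) := by
    rw [← Real.rpow_mul_natCast two_pos.le, ← Real.rpow_add two_pos]
    exact Real.rpow_le_rpow_of_exponent_le one_le_two (by linarith)
  have t1' : ∑ i, fPot b (W i).bhatt ≤ 2 ^ n := by
    refine (Finset.sum_le_sum fun i _ =>
      fPot_le_one hb.1.le (W i).bhatt_nonneg (W i).bhatt_le_one).trans_eq ?_
    simp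
  have t2 : (2 : ℝ) ^ k * 2 ^ m ≤ 2 ^ n * 2 ^ (-(n / μ)) := by
    rw [← pow_add, ← Real.rpow_natCast, e2n, ← Real.rpow_add two_pos]
    exact Real.rpow_le_rpow_of_exponent_le one_le_two (by push_cast; linarith)
  have t3 : ((2 : ℝ) ^ (1 / 4 : ℝ) / 2) ^ m * (1 / (Pe / 2 ^ n)) ^ s ≤
      2 * (1 / Pe) ^ s * 2 ^ (-(n / μ)) := by
    have e1 : (2 : ℝ) ^ (1 / 4 : ℝ) / 2 = 2 ^ (-(3 / 4) : ℝ) := by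
      nth_rewrite 2 [← Real.rpow_one 2]
      rw [← Real.rpow_sub two_pos]; norm_num
    have e3 : 1 / (Pe / 2 ^ n) = 1 / Pe * 2 ^ (n : ℝ) := by rw [← e2n]; field_simp
    rw [e1, e3, Real.mul_rpow (one_div_pos.2 hPe.1).le (by positivity), ← Real.rpow_mul two_pos.le,
      ← Real.rpow_mul_natCast two_pos.le]
    -- By m ≥ 2n/μ - 1 the exponent is at most 3/4 - (3/2)(n/μ) + (1/4)(n/μ) ≤ 1 - n/μ.
    have e4 : (2 : ℝ) ^ (-(3 / 4) * m : ℝ) * 2 ^ (n * s : ℝ) ≤ 2 * 2 ^ (-(n / μ)) := by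
      nth_rewrite 3 [← Real.rpow_one 2]
      rw [← Real.rpow_add two_pos, ← Real.rpow_add two_pos]
      refine Real.rpow_le_rpow_of_exponent_le one_le_two ?_
      have e5 : n * s = n / μ / 4 := by rw [hs]; field_simp
      have e6 : 0 ≤ n / μ := by positivity
      rw [e5]; linarith
    nlinarith [mul_le_mul_of_nonneg_left e4 hPs.le]
  have q1 : 4 * a * (2 ^ (-η)) ^ k * ∑ i, fPot b (W i).bhatt ≤
      4 * a * (2 ^ η * 2 ^ (-(n / μ))) * 2 ^ n := by
    have hf : 0 ≤ ∑ i, fPot b (W i).bhatt := Finset.sum_nonneg fun i _ =>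
      fPot_nonneg (W i).bhatt_nonneg (W i).bhatt_le_one
    gcongr
  have q2 : 2 ^ k * (3 * a * 2 ^ m + 4 * a * g) - 4 * a * g ≤
      (3 * a + 4 * a * g) * (2 ^ n * 2 ^ (-(n / μ))) := by
    have h1m : (1 : ℝ) ≤ 2 ^ m := one_le_pow₀ one_le_two
    have hag : 0 ≤ 4 * a * g := by positivity
    calc 2 ^ k * (3 * a * 2 ^ m + 4 * a * g) - 4 * a * g
        ≤ 2 ^ k * (3 * a * 2 ^ m + 4 * a * g * 2 ^ m) := by
          have : 4 * a * g ≤ 4 * a * g * 2 ^ m := le_mul_of_one_le_right hag h1m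
          have h2k : (0 : ℝ) < 2 ^ k := by positivity
          nlinarith
      _ = (3 * a + 4 * a * g) * (2 ^ k * 2 ^ m) := by ring
      _ ≤ _ := by gcongr
  have q3 := mul_le_mul_of_nonneg_left t3 h2n.le
  linarith

theorem rpow_bound_of_le {C d μ : ℝ} {n : ℕ} (hC : 0 < C) (hμ : 0 < μ) (hd : 0 < d)
    (h : d ≤ C * 2 ^ (-(n / μ))) : (2 : ℝ) ^ n ≤ C ^ μ / d ^ μ := by
  rw [le_div_iff₀ (Real.rpow_pos_of_pos hd _)]
  calc (2 : ℝ) ^ n * d ^ μ ≤ 2 ^ n * (C * 2 ^ (-(n / μ))) ^ μ := by gcongr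
    _ = 2 ^ n * (C ^ μ * 2 ^ (-(n : ℝ))) := by
      rw [Real.mul_rpow hC.le (by positivity), ← Real.rpow_mul two_pos.le]
      congr 3
      field_simp
    _ = C ^ μ := by
      rw [Real.rpow_neg two_pos.le, Real.rpow_natCast]
      field_simp

end NonstationaryPolar
end

/-! ### Proof of the theorem -/

theorem mainTheorem2
    (b c lam : ℝ) (hb : b ∈ Set.Ioo (0 : ℝ) 1) (hc : c ∈ Set.Ioo (0 : ℝ) (1 / 2)) (hlam : 0 < lam)
    (heta : 0 < NonstationaryPolar.eta b c lam)
    (Pe : ℝ) (hPe : Pe ∈ Set.Ioo (0 : ℝ) 1)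
    (μ : ℝ) (hμ : 2 + Real.logb 2 3 + 1 / NonstationaryPolar.eta b c lam < μ) :
    ∃ κ : ℝ, 0 < κ ∧
      ∀ (n : ℕ) (W : Fin (2 ^ n) → NonstationaryPolar.Channel.{u}), (∀ i, (W i).IsBMS) →
        ∃ C : NonstationaryPolar.TwoStageCode n,
          (∀ p, p ∈ C.info ↔ (C.bitChannel W p).bhatt ≤ Pe / 2 ^ n) ∧
          C.blockError W ≤ Pe ∧
          (C.rate < NonstationaryPolar.avgCap W →
            (2 : ℝ) ^ n ≤ κ / (NonstationaryPolar.avgCap W - C.rate) ^ μ) := by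
  classical
  have hlog : 1 ≤ Real.logb 2 3 := by
    rw [Real.le_logb_iff_rpow_le one_lt_two (by norm_num)]; norm_num
  have hμ3 : 3 + 1 / NonstationaryPolar.eta b c lam ≤ μ := by linarith
  have hμ0 : 0 < μ := by
    have : 0 < 1 / NonstationaryPolar.eta b c lam := by positivity
    linarith
  obtain ⟨K, hK, hpol⟩ := NonstationaryPolar.exists_polarization.{u} hb hc hlam heta hPe hμ3
  refine ⟨K ^ μ, Real.rpow_pos_of_pos hK _, fun n W hW => ?_⟩
  obtain ⟨P, hP⟩ := hpol n W
  set info : Finset (Fin (2 ^ n) × Fin (2 ^ 0)) :=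
    Finset.univ.filter fun p => (P.channels W p.1).bhatt ≤ Pe / 2 ^ n with hinfo
  have h2n : (0 : ℝ) < 2 ^ n := by positivity
  have hcard : (info.card : ℝ) =
      ∑ i, if (P.channels W i).bhatt ≤ Pe / 2 ^ n then (1 : ℝ) else 0 := by
    rw [hinfo, Finset.card_filter, Nat.cast_sum, Fintype.sum_prod_type]
    refine Finset.sum_congr rfl fun i _ => ?_
    simp
  refine ⟨NonstationaryPolar.singleSetCode P info, fun p => ?_, ?_, fun hR => ?_⟩
  · exact Finset.mem_filter.trans (and_iff_right (Finset.mem_univ _))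
  · refine (NonstationaryPolar.TwoStageCode.singleSetCode_blockError_le P info W hW).trans ?_
    have hle : ∀ p : info, (P.channels W p.1.1).bhatt ≤ Pe / 2 ^ n := fun p =>
      (Finset.mem_filter.1 p.2).2
    refine (Finset.sum_le_sum fun p _ => hle p).trans ?_
    rw [Finset.sum_const, Finset.card_univ, Fintype.card_coe, nsmul_eq_mul, mul_div_assoc',
      div_le_iff₀ h2n, mul_comm]
    refine mul_le_mul_of_nonneg_left ?_ hPe.1.le
    have : info.card ≤ 2 ^ n := (Finset.card_le_univ info).trans_eq (by simp)
    exact_mod_cast this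
  · refine NonstationaryPolar.rpow_bound_of_le hK hμ0 (sub_pos.2 hR) ?_
    have hrate : (NonstationaryPolar.singleSetCode P info).rate = info.card / 2 ^ n := rfl
    rw [hrate, hcard]
    unfold NonstationaryPolar.avgCap
    push_cast
    -- By conservation of capacity, N times the gap to capacity is the total loss of the final
    -- bit-channels.
    rw [← P.sum_symCap_channels W, ← sub_div, div_le_iff₀ h2n, ← Finset.sum_sub_distrib]
    calc _ = ∑ i, NonstationaryPolar.loss (Pe / 2 ^ n) (P.channels W i) := by
          refine Finset.sum_congr rfl fun i _ => ?_
          unfold NonstationaryPolar.loss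
          congr
      _ ≤ _ := hP.trans_eq (by ring)
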